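/- \textbf{Setting.} Let $H=\mathbb C((t))$, $H'=H/\mathbb C$, with the symplectic form $\langle f,g\rangle=-\operatorname{Res}_{t=0} f\,dg$, and $H'_+=t\mathbb C[[t]]\subset H'$. Let $\Gamma$ be a positive-definite even lattice of finite rank, $\mathfrak h_\Gamma=\Gamma\otimes_{\mathbb Z}\mathbb C$, and let $\widehat{\mathfrak h}_\Gamma=\mathfrak h_\Gamma((t))\oplus\mathbb C\mathbf 1$ be the Heisenberg Lie algebra, with $\mathbf 1$ central and $[A\otimes f,B\otimes g]=-(A,B)(\operatorname{Res} f\,dg)\mathbf 1$. Let $\pi^0_\Gamma$ be the level-$0$ Heisenberg vertex algebra, i.e. the $\widehat{\mathfrak h}_\Gamma$-module induced from the one-dimensional module $\mathbb C|0\rangle$ of $\mathfrak h_\Gamma[[t]]\oplus\mathbb C\mathbf 1$ on which everything acts by $0$. Since $A\otimes t^0$ acts on it by $0$, $A\otimes f$ acts on it for $A\in\mathfrak h_\Gamma$, $f\in H'$. A PPAV $(X,\Theta)$ is a complex torus $X=W/\Lambda$ with a positive-definite Hermitian form $B$ on $W$ (antilinear in the first variable) such that $\operatorname{Im}B$ is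 integral and unimodular on $\Lambda$; then $T_0X=W$, and evaluation of one-forms at the origin is a map $W\to H^0(X,\Omega^1_X)^*$. An extended PPAV of dimension $g$ is a triple $a=(Z,F,L)$ with $Z=Z^\perp\subset H'$, $F\subset Z$ of codimension $g$, and $L$ a lattice of rank $2g$ in $F^\perp/F$, such that $Z\cap H'_+=0$; $L_{\mathbb R}\cap F^\perp_+=0$ in $F^\perp/F$, where $F^\perp_+=F^\perp\cap H'_+$; the complex conjugation of $F^\perp/F$ defined by $L_{\mathbb R}$ takes $Z/F$ to $F^\perp_+$; $\frac1{2\pi i}\langle\,,\rangle$ is integral and unimodular on $L$; and $B_a(u,v)=\frac1\pi\langle\overline u,v\rangle$ is positive definite on $Z/F$. Its underlying PPAV is the quotient of $Z/F$ by the image of $L$ under the projection $F^\perp/F\to Z/F$ along $F^\perp_+$, with the form $B_a$. Let $\mathrm{Sp}(X,\Theta)$ be the set of pairs $x=(a,\iota)$ of an extended PPAV $a=(Z,F,L)$ and an isomorphism $\iota$ from its underlying PPAV to $(X,\Theta)$; for such $x$ write $\iota_x\colon Z\to Z/F\cong W\to H^0(X,\Omega^1_X)^*$ for the induced map. Let $\mathbb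 S\mathrm p^+(H')$ be the identity component (for the weak operator topology) of the group of continuous symplectic automorphisms $\rho$ of $H'$ with $\rho(H'_+)=H'_+$. It acts on $\mathrm{Sp}(X,\Theta)$, and it acts on $\pi^0_\Gamma$ by fixing $|0\rangle$ and by $\rho\circ(A\otimes f)\circ\rho^{-1}=A\otimes\rho(f)$. The space of coinvariants at $a=(Z,F,L)$ is $\widehat{\mathbb V}(a,\pi^0_\Gamma)=\pi^0_\Gamma/(\mathfrak h_\Gamma\otimes F)\,\pi^0_\Gamma$. The space of coinvariants $\mathbb V(X,\Theta,\pi^0_\Gamma)$ of the PPAV is obtained from these by descent along $\mathrm{Sp}(X,\Theta)$: it is the space of families $(v_x)_{x\in\mathrm{Sp}(X,\Theta)}$ with $v_x\in\widehat{\mathbb V}(a,\pi^0_\Gamma)$ for $x=(a,\iota)$ and $\rho\,v_x=v_{\rho x}$ for all $\rho\in\mathbb S\mathrm p^+(H')$. \textbf{Theorem.} Let $(X,\Theta)$ be a PPAV. For every $x=(a,\iota)$ in $\mathrm{Sp}(X,\Theta)$ the evaluation $\mathbb V(X,\Theta,\pi^0_\Gamma)\to\widehat{\mathbb V}(a,\pi^0_\Gamma)$,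 $v\mapsto v_x$, is bijective, and there is a canonical isomorphism \[ \mathbb V(X,\Theta,\pi^0_\Gamma)\;\cong\;\mathrm{Sym}\bigl(\mathfrak h_\Gamma\otimes_{\mathbb C}H^0(X,\Omega^1_X)^*\bigr), \] namely a unique linear isomorphism that, for all $x=(a,\iota)$ with $a=(Z,F,L)$, all $A_i\in\mathfrak h_\Gamma$ and all $f_i\in Z$, sends every $v$ with $v_x=[(A_1\otimes f_1)\cdots(A_k\otimes f_k)|0\rangle]$ to $\prod_i A_i\otimes\iota_x(f_i)$. Equivalently, \[ \mathbb V(X,\Theta,\pi^0_\Gamma)\cong\mathrm{Fun}\bigl(\mathfrak h_\Gamma\otimes_{\mathbb C}H^0(X,\Omega^1_X)\bigr), \] the ring of polynomial functions, by the unique linear isomorphism sending such a $v$ to the product of the linear forms $B\otimes\eta\mapsto(A_i,B)\,\iota_x(f_i)(\eta)$. In particular, if $\Gamma$ has rank one and $h\in\mathfrak h_\Gamma$ satisfies $(h,h)=1$, there are unique linear isomorphisms $\mathbb V(X,\Theta,\pi^0_\Gamma)\cong\mathrm{Sym}(H^0(X,\Omega^1_X)^*)$ and $\mathbb V(X,\Theta,\pi^0_\Gamma)\cong\mathrm{Fun}(H^0(X,\Omega^1_X))$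 which send every $v$ with $v_x=[(h\otimes f_1)\cdots(h\otimes f_k)|0\rangle]$, $f_i\in Z$, to $\prod_i\iota_x(f_i)$, respectively to the function $\eta\mapsto\prod_i\iota_x(f_i)(\eta)$. -/

import Mathlib

open scoped TensorProduct

noncomputable section

namespace AbelianCoinvariants

/-! ### The symplectic space `H' = ℂ((t)) / ℂ` -/

/-- The space `H = ℂ((t))`. -/
def H : Type := LaurentSeries ℂ

instance : AddCommGroup H := inferInstanceAs (AddCommGroup (HahnSeries ℤ ℂ))

instance : Module ℂ H := HahnSeries.instModule (Γ := ℤ) (R := ℂ) (V := ℂ)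

/-- The `n`-th coefficient of a Laurent series. -/
def coeff (n : ℤ) : H →ₗ[ℂ] ℂ where
  toFun f := HahnSeries.coeff f n
  map_add' _ _ := rfl
  map_smul' _ _ := rfl

/-- The constant series `b₀ = 1`. -/
def bZero : H := (1 : LaurentSeries ℂ)

theorem coeff_bZero (n : ℤ) : coeff n bZero = if n = 0 then 1 else 0 := by
  refine (HahnSeries.coeff_one (R := ℂ) (a := n)).trans ?_
  congr

/-- The product of Laurent series. -/
def mulH (f g : H) : H := HMul.hMul (α := LaurentSeries ℂ) (β := LaurentSeries ℂ) f g

theorem smul_eq_mulH (c : ℂ) (f : H) : c • f = mulH (HahnSeries.single (0 : ℤ) c) f :=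
  (HahnSeries.single_zero_mul_eq_smul (Γ := ℤ) (r := c) (x := f)).symm

/-- The derivative of Laurent series. -/
def derivH : H →ₗ[ℂ] H := LaurentSeries.derivative (V := ℂ) ℂ

theorem coeff_derivH (n : ℤ) (f : H) : coeff n (derivH f) = ((n + 1 : ℤ) : ℂ) * coeff (n + 1) f := by
  have h : coeff n (derivH f) = Ring.choose (n + ((1 : ℕ) : ℤ)) 1 • coeff (n + ((1 : ℕ) : ℤ)) f := rfl
  rw [h, Ring.choose_one_right, Nat.cast_one, zsmul_eq_mul]

/-- The form `⟨f, g⟩ = - Res f dg` on `H`. -/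
def formH : H →ₗ[ℂ] H →ₗ[ℂ] ℂ :=
  LinearMap.mk₂ ℂ (fun f g => -coeff (-1) (mulH f (derivH g)))
    (fun f f' g => by
      have h : mulH (f + f') (derivH g) = mulH f (derivH g) + mulH f' (derivH g) :=
        add_mul (R := LaurentSeries ℂ) f f' (derivH g)
      rw [h, map_add, neg_add])
    (fun c f g => by
      have h : mulH (c • f) (derivH g) = c • mulH f (derivH g) := by
        rw [smul_eq_mulH, smul_eq_mulH]
        exact mul_assoc (G := LaurentSeries ℂ) _ _ _
      rw [h, map_smul, smul_neg])
    (fun f g g' => by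
      have h : mulH f (derivH g + derivH g') = mulH f (derivH g) + mulH f (derivH g') :=
        mul_add (R := LaurentSeries ℂ) f (derivH g) (derivH g')
      rw [map_add, h, map_add, neg_add])
    (fun c f g => by
      have h : mulH f (c • derivH g) = c • mulH f (derivH g) := by
        rw [smul_eq_mulH, smul_eq_mulH]
        exact mul_left_comm (G := LaurentSeries ℂ) _ _ _
      rw [map_smul, h, map_smul, smul_neg])

theorem formH_apply (f g : H) : formH f g = -coeff (-1) (mulH f (derivH g)) := rfl

theorem formH_eq_finsum (f g : H) :
    formH f g = -∑ᶠ n : ℤ, (n : ℂ) * coeff (-n) f * coeff n g := by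
  classical
  rw [formH_apply]
  congr 1
  have h0 : coeff (-1) (mulH f (derivH g)) =
      ∑ p ∈ Finset.antidiagonal (HahnSeries.isPWO_support f)
        (HahnSeries.isPWO_support (derivH g)) (-1), coeff p.1 f * coeff p.2 (derivH g) := rfl
  rw [h0]
  have hinj : Set.InjOn (fun p : ℤ × ℤ => p.2 + 1)
      (Finset.antidiagonal (HahnSeries.isPWO_support f)
        (HahnSeries.isPWO_support (derivH g)) (-1) : Set (ℤ × ℤ)) := by
    rintro ⟨a, b⟩ h1 ⟨c, d⟩ h2 h
    simp only [Finset.mem_coe, Finset.mem_antidiagonal] at h1 h2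
    simp only at h
    ext <;> simp only <;> omega
  rw [finsum_eq_sum_of_support_subset (s := (Finset.antidiagonal (HahnSeries.isPWO_support f)
      (HahnSeries.isPWO_support (derivH g)) (-1)).image (fun p : ℤ × ℤ => p.2 + 1)),
    Finset.sum_image hinj]
  · refine Finset.sum_congr rfl fun p hp => ?_
    rw [Finset.mem_antidiagonal] at hp
    have h1 : p.1 = -(p.2 + 1) := by omega
    rw [coeff_derivH, ← h1]
    ring
  · intro n hn
    rw [Function.mem_support] at hn
    have h1 : (n : ℂ) ≠ 0 := fun h => hn (by simp [h])
    have h2 : coeff (-n) f ≠ 0 := fun h => hn (by simp [h])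
    have h3 : coeff n g ≠ 0 := fun h => hn (by simp [h])
    simp only [Finset.coe_image, Set.mem_image, Finset.mem_coe, Finset.mem_antidiagonal]
    refine ⟨(-n, n - 1), ⟨h2, ?_, by ring⟩, by simp⟩
    change coeff (n - 1) (derivH g) ≠ 0
    rw [coeff_derivH, sub_add_cancel]
    exact mul_ne_zero h1 h3

theorem formH_skew (f g : H) : formH f g = -formH g f := by
  rw [formH_eq_finsum, formH_eq_finsum, neg_neg, ← finsum_neg_distrib,
    ← finsum_comp_equiv (Equiv.neg ℤ)]
  refine finsum_congr fun n => ?_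
  simp
  ring

/-- The line `ℂ b₀` of constants in `H`. -/
def constLine : Submodule ℂ H := Submodule.span ℂ {bZero}

theorem bZero_mem : bZero ∈ constLine := Submodule.subset_span rfl

theorem formH_const_right (f : H) {g : H} (hg : g ∈ constLine) : formH f g = 0 := by
  obtain ⟨c, rfl⟩ := Submodule.mem_span_singleton.1 hg
  rw [map_smul, formH_eq_finsum]
  have : (fun n : ℤ => (n : ℂ) * coeff (-n) f * coeff n bZero) = fun _ => 0 := by
    funext n
    by_cases h : n = 0 <;> simp [h, coeff_bZero]
  rw [this, finsum_zero, neg_zero, smul_zero]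

theorem formH_const_left {f : H} (hf : f ∈ constLine) (g : H) : formH f g = 0 := by
  rw [formH_skew, formH_const_right g hf, neg_zero]

/-- The space `H' = H / ℂ b₀`. -/
abbrev H' : Type := H ⧸ constLine

/-- The symplectic form on `H'` induced by `- Res f dg`. -/
def form : H' →ₗ[ℂ] H' →ₗ[ℂ] ℂ :=
  formH.liftQ₂ constLine constLine
    (fun _ hf => LinearMap.ext fun g => formH_const_left hf g)
    (fun _ hg => LinearMap.ext fun f => formH_const_right f hg)

theorem form_mk (f g : H) : form (constLine.mkQ f) (constLine.mkQ g) = formH f g := rfl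

theorem form_skew (f g : H') : form f g = -form g f := by
  obtain ⟨f, rfl⟩ := constLine.mkQ_surjective f
  obtain ⟨g, rfl⟩ := constLine.mkQ_surjective g
  exact formH_skew f g

/-- The subspace `t ^ n ℂ[[t]]` of `H`. -/
def tPow (n : ℤ) : Submodule ℂ H := ⨅ m : {m : ℤ // m < n}, LinearMap.ker (coeff m)

theorem mem_tPow {n : ℤ} {f : H} : f ∈ tPow n ↔ ∀ m < n, coeff m f = 0 := by
  simp [tPow, Submodule.mem_iInf]

/-- The image of `t ^ n ℂ[[t]]` in `H'`; these subspaces define the `t`-adic topology of `H'`. -/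
def filt (n : ℤ) : Submodule ℂ H' := (tPow n).map constLine.mkQ

/-- The subspace `H'₊ = t ℂ[[t]]` of `H'`. -/
def Hplus : Submodule ℂ H' := filt 1

/-- The representative in `H` with vanishing constant term of a class in `H'`. -/
def sec : H' →ₗ[ℂ] H :=
  constLine.liftQ (LinearMap.id - (coeff 0).smulRight bZero) (by
    intro f hf
    obtain ⟨c, rfl⟩ := Submodule.mem_span_singleton.1 hf
    simp [coeff_bZero])

theorem sec_mk (f : H) : sec (constLine.mkQ f) = f - coeff 0 f • bZero := rfl

theorem mk_bZero : constLine.mkQ bZero = 0 := by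
  rw [← LinearMap.mem_ker, Submodule.ker_mkQ]
  exact bZero_mem

theorem mk_sec (f : H') : constLine.mkQ (sec f) = f := by
  obtain ⟨f, rfl⟩ := constLine.mkQ_surjective f
  rw [sec_mk, map_sub, map_smul, mk_bZero, smul_zero, sub_zero]

theorem coeff_sec (f : H') : coeff 0 (sec f) = 0 := by
  obtain ⟨f, rfl⟩ := constLine.mkQ_surjective f
  rw [sec_mk, map_sub, map_smul, coeff_bZero]
  simp

theorem sub_mem_tPow {f : H} (hf : ∀ m < 0, coeff m f = 0) : f - coeff 0 f • bZero ∈ tPow 1 := by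
  rw [mem_tPow]
  intro m hm
  rw [map_sub, map_smul, coeff_bZero]
  by_cases h : m = 0
  · simp [h]
  · simp [h, hf m (by omega)]

theorem sec_mem_tPow {f : H'} (hf : f ∈ Hplus) : sec f ∈ tPow 1 := by
  obtain ⟨f, hf, rfl⟩ := hf
  exact sub_mem_tPow fun m hm => mem_tPow.1 hf m (by omega)

/-! ### The symplectic group -/

/-- Continuity of a linear endomorphism of `H'` in the `t`-adic topology. -/
def TAdicContinuous (T : H' →ₗ[ℂ] H') : Prop :=
  ∀ n : ℤ, ∃ m : ℤ, filt m ≤ (filt n).comap T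

/-- The group of bicontinuous symplectic automorphisms `ρ` of `H'` with `ρ(H'₊) = H'₊`. -/
def SpFull : Subgroup (H' ≃ₗ[ℂ] H') where
  carrier := {ρ | TAdicContinuous ρ.toLinearMap ∧ TAdicContinuous ρ.symm.toLinearMap ∧
    (∀ f g, form (ρ f) (ρ g) = form f g) ∧ ∀ f, ρ f ∈ Hplus ↔ f ∈ Hplus}
  one_mem' := ⟨fun n => ⟨n, le_rfl⟩, fun n => ⟨n, le_rfl⟩, fun _ _ => rfl, fun _ => Iff.rfl⟩
  mul_mem' := by
    rintro ρ σ ⟨h1, h2, h3, h4⟩ ⟨k1, k2, k3, k4⟩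
    refine ⟨fun n => ?_, fun n => ?_, fun f g => (h3 _ _).trans (k3 _ _),
      fun f => (h4 _).trans (k4 _)⟩
    · obtain ⟨m, hm⟩ := h1 n
      obtain ⟨l, hl⟩ := k1 m
      exact ⟨l, fun f hf => hm (hl hf)⟩
    · obtain ⟨m, hm⟩ := k2 n
      obtain ⟨l, hl⟩ := h2 m
      exact ⟨l, fun f hf => hm (hl hf)⟩
  inv_mem' := by
    rintro ρ ⟨h1, h2, h3, h4⟩
    refine ⟨h2, h1, fun f g => ?_, fun f => ?_⟩
    · have := h3 (ρ.symm f) (ρ.symm g)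
      rw [ρ.apply_symm_apply, ρ.apply_symm_apply] at this
      exact this.symm
    · have := h4 (ρ.symm f)
      rw [ρ.apply_symm_apply] at this
      exact this.symm

/-- The weak operator topology: the coarsest one for which all the matrix coefficients
`ρ ↦ ⟨ρ f, g⟩` are continuous, with the usual topology on `ℂ`. -/
instance : TopologicalSpace SpFull :=
  TopologicalSpace.induced (fun ρ (p : H' × H') => form (ρ.1 p.1) p.2) inferInstance

/-- The group `Sp⁺(H')`: the connected component of the identity. -/
def SpPlus : Set SpFull := connectedComponent 1

/-! ### Extended principally polarized abelian varieties -/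

/-- The orthogonal `F^⊥` in `H'`. -/
def perp (F : Submodule ℂ H') : Submodule ℂ H' := F.orthogonalBilin form

/-- The space `F^⊥ / F` (for `F` isotropic). -/
abbrev Red (F : Submodule ℂ H') : Type := ↥(perp F) ⧸ F.submoduleOf (perp F)

instance (F : Submodule ℂ H') : Module ℝ (Red F) := Module.complexToReal (Red F)

instance (F : Submodule ℂ H') : IsScalarTower ℝ ℂ (Red F) := IsScalarTower.complexToReal

/-- The form induced on `F^⊥ / F`. -/
def redForm (F : Submodule ℂ H') : Red F →ₗ[ℂ] Red F →ₗ[ℂ] ℂ :=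
  (form.domRestrict₁₂ (perp F) (perp F)).liftQ₂ (F.submoduleOf (perp F)) (F.submoduleOf (perp F))
    (fun f hf => LinearMap.ext fun g => g.2 f.1 hf)
    (fun g hg => LinearMap.ext fun f => (form_skew f.1 g.1).trans
      (neg_eq_zero.2 (f.2 g.1 hg)))

/-- The image in `F^⊥ / F` of `F^⊥₊ = F^⊥ ∩ H'₊`. -/
def redPlus (F : Submodule ℂ H') : Submodule ℂ (Red F) :=
  (Hplus.submoduleOf (perp F)).map (F.submoduleOf (perp F)).mkQ

theorem le_perp {F Z : Submodule ℂ H'} (hF : F ≤ Z) (hZ : perp Z = Z) : Z ≤ perp F :=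
  fun _ hf g hg => (hZ.ge hf) g (hF hg)

/-- The map `Z / F → F^⊥ / F` induced by an inclusion `Z ⊆ F^⊥`. -/
def redIncl {F Z : Submodule ℂ H'} (h : Z ≤ perp F) : (↥Z ⧸ F.submoduleOf Z) →ₗ[ℂ] Red F :=
  (F.submoduleOf Z).mapQ (F.submoduleOf (perp F)) (Submodule.inclusion h) (fun _ hf => hf)

/-- `u'` is the conjugate of `u` for the real structure with real part `L_ℝ`, the real span
of `L`. -/
def IsConj {F : Submodule ℂ H'} (L : Submodule ℤ (Red F)) (u u' : Red F) : Prop :=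
  ∃ x ∈ Submodule.span ℝ (L : Set (Red F)), ∃ y ∈ Submodule.span ℝ (L : Set (Red F)),
    u = x + Complex.I • y ∧ u' = x - Complex.I • y

/-- An extended PPAV `(Z, F, L)` of dimension `g`. -/
structure ExtPPAV (g : ℕ) where
  Z : Submodule ℂ H'
  F : Submodule ℂ H'
  F_le : F ≤ Z
  lagrangian : perp Z = Z
  finite : Module.Finite ℂ (↥Z ⧸ F.submoduleOf Z)
  codim : Module.finrank ℂ (↥Z ⧸ F.submoduleOf Z) = g
  L : Submodule ℤ (Red F)
  L_fg : L.FG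
  L_rank : Module.finrank ℤ L = 2 * g
  disjoint_plus : Z ⊓ Hplus = ⊥
  disjoint_real : ∀ x ∈ Submodule.span ℝ (L : Set (Red F)), x ∈ redPlus F → x = 0
  /-- The real structure given by `L_ℝ` takes `Z / F` to `F^⊥₊`. -/
  conj_plus : ∀ u : ↥Z ⧸ F.submoduleOf Z, ∃ u' ∈ redPlus F,
    IsConj L (redIncl (le_perp F_le lagrangian) u) u'
  integral : ∀ l ∈ L, ∀ m ∈ L, ∃ n : ℤ, redForm F l m = 2 * Real.pi * Complex.I * n
  unimodular : ∀ φ : L →ₗ[ℤ] ℤ, ∃! l : L, ∀ m : L,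
    redForm F l.1 m.1 = 2 * Real.pi * Complex.I * (φ m : ℤ)
  /-- Positivity of the form `B(u, v) = ⟨ū, v⟩ / π` on `Z / F`. -/
  positive : ∀ u : ↥Z ⧸ F.submoduleOf Z, u ≠ 0 → ∀ u',
    IsConj L (redIncl (le_perp F_le lagrangian) u) u' →
      0 < ((1 / Real.pi : ℂ) * redForm F u' (redIncl (le_perp F_le lagrangian) u)).re

namespace ExtPPAV

variable {g : ℕ} (a : ExtPPAV g)

/-- The space `Z / F`. -/
abbrev Tangent : Type := ↥a.Z ⧸ a.F.submoduleOf a.Z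

/-- The inclusion `Z / F → F^⊥ / F`. -/
def incl : a.Tangent →ₗ[ℂ] Red a.F := redIncl (le_perp a.F_le a.lagrangian)

end ExtPPAV

/-! ### Principally polarized abelian varieties -/

/-- A principally polarized abelian variety `(X, Θ)`: the complex torus `X = W / Λ` together with a
positive definite Hermitian form `B` (antilinear in the first variable) on `W` whose imaginary part
is integral and unimodular on `Λ`. -/
structure PPAV (W : Type*) [NormedAddCommGroup W] [NormedSpace ℂ W] where
  Λ : Submodule ℤ W
  discrete : DiscreteTopology Λ
  span_top : Submodule.span ℝ (Λ : Set W) = ⊤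
  B : W →ₗ⋆[ℂ] W →ₗ[ℂ] ℂ
  hermitian : ∀ u v, (starRingEnd ℂ) (B u v) = B v u
  positive : ∀ u, u ≠ 0 → 0 < (B u u).re
  integral : ∀ u ∈ Λ, ∀ v ∈ Λ, ∃ n : ℤ, (B u v).im = n
  unimodular : ∀ φ : Λ →ₗ[ℤ] ℤ, ∃! u : Λ, ∀ v : Λ, (B u.1 v.1).im = (φ v : ℤ)

section

variable {W : Type*} [NormedAddCommGroup W] [NormedSpace ℂ W]

namespace PPAV

/-- The underlying complex torus. -/
abbrev X (P : PPAV W) : Type _ := W ⧸ P.Λ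

/-- The space `H⁰(X, Ω¹_X)` of global holomorphic one-forms on `X`. The inverse branches of
`W → X` are the charts of `X`, and the changes of charts are translations, so that a one-form on `X`
is a function from `X` to the dual of `W`; it is holomorphic when its pull-back to `W` is. -/
def OneForms (P : PPAV W) : Submodule ℂ (P.X → (W →L[ℂ] ℂ)) where
  carrier := {η | Differentiable ℂ fun w : W => η (P.Λ.mkQ w)}
  add_mem' h k := Differentiable.add h k
  zero_mem' := differentiable_const _
  smul_mem' c _ h := Differentiable.const_smul h c

/-- The canonical map `T₀ X = W → H⁰(X, Ω¹_X)^*`. -/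
def tangentToDual (P : PPAV W) : W →ₗ[ℂ] Module.Dual ℂ P.OneForms where
  toFun w :=
    { toFun := fun η => η.1 0 w
      map_add' := fun _ _ => rfl
      map_smul' := fun _ _ => rfl }
  map_add' w w' := LinearMap.ext fun η => map_add (η.1 0) w w'
  map_smul' c w := LinearMap.ext fun η => map_smul (η.1 0) c w

end PPAV

/-- A point of `Sp(X, Θ)`, the fiber over `(X, Θ)` of the map from extended PPAVs to PPAVs: an
extended PPAV `a = (Z, F, L)` with an isomorphism from its underlying PPAV to `(X, Θ)`, that is, a
linear isomorphism `Z / F ≅ W` that takes the image of `L` under the projection `F^⊥ / F → Z / F`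
along `F^⊥₊` onto `Λ`, and the Hermitian form `⟨ū, v⟩ / π` to `B`. -/
structure Sp (P : PPAV W) where
  a : ExtPPAV (Module.finrank ℂ W)
  iso : a.Tangent ≃ₗ[ℂ] W
  iso_lattice : ∀ u : a.Tangent, iso u ∈ P.Λ ↔ ∃ p ∈ redPlus a.F, a.incl u + p ∈ a.L
  iso_form : ∀ (u v : a.Tangent) (u' : Red a.F), IsConj a.L (a.incl u) u' →
    P.B (iso u) (iso v) = (1 / Real.pi : ℂ) * redForm a.F u' (a.incl v)

namespace Sp

variable {P : PPAV W}

/-- The composition `Z → Z / F ≅ T₀ X → H⁰(X, Ω¹_X)^*`. -/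
def toDual (x : Sp P) : x.a.Z →ₗ[ℂ] Module.Dual ℂ P.OneForms :=
  P.tangentToDual ∘ₗ x.iso.toLinearMap ∘ₗ (x.a.F.submoduleOf x.a.Z).mkQ

/-- The relation `ρ x = x'` for the action of symplectic automorphisms on `Sp(X, Θ)`. -/
structure Moves (ρ : SpFull) (x x' : Sp P) : Prop where
  map_Z : ∀ f, ρ.1 f ∈ x'.a.Z ↔ f ∈ x.a.Z
  map_F : ∀ f, ρ.1 f ∈ x'.a.F ↔ f ∈ x.a.F
  map_L : ∀ (f : perp x.a.F) (f' : perp x'.a.F), f'.1 = ρ.1 f.1 →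
    ((x'.a.F.submoduleOf _).mkQ f' ∈ x'.a.L ↔ (x.a.F.submoduleOf _).mkQ f ∈ x.a.L)
  map_iso : ∀ (f : x.a.Z) (f' : x'.a.Z), f'.1 = ρ.1 f.1 →
    x'.iso ((x'.a.F.submoduleOf _).mkQ f') = x.iso ((x.a.F.submoduleOf _).mkQ f)

end Sp

end

/-! ### Heisenberg vertex algebras -/

/-- A positive definite even lattice structure on an abelian group `Γ`. -/
structure EvenLattice (Γ : Type*) [AddCommGroup Γ] where
  q : LinearMap.BilinForm ℤ Γ
  symm : ∀ x y, q x y = q y x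
  even : ∀ x, Even (q x x)
  positive : ∀ x, x ≠ 0 → 0 < q x x

/-- The complex vector space `𝔥_Γ = Γ ⊗ ℂ`. -/
abbrev Cartan (Γ : Type*) [AddCommGroup Γ] : Type _ := ℂ ⊗[ℤ] Γ

variable {Γ : Type*} [AddCommGroup Γ] (q : EvenLattice Γ)

/-- The bilinear form on `𝔥_Γ`. -/
def cartanForm : LinearMap.BilinForm ℂ (Cartan Γ) := q.q.baseChange ℂ

theorem cartanForm_symm (x y : Cartan Γ) : cartanForm q x y = cartanForm q y x := by
  induction x using TensorProduct.induction_on with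
  | zero => simp
  | add x x' hx hx' => simp only [map_add, LinearMap.add_apply, hx, hx']
  | tmul a x =>
    induction y using TensorProduct.induction_on with
    | zero => simp
    | add y y' hy hy' => simp only [map_add, LinearMap.add_apply, hy, hy']
    | tmul b y =>
      rw [cartanForm, LinearMap.BilinForm.baseChange_tmul, LinearMap.BilinForm.baseChange_tmul,
        q.symm x y, mul_comm a b]

/-- The cocycle `(A ⊗ f, B ⊗ g) ↦ - (A, B) Res f dg` on `𝔥_Γ((t))`. -/
def loopForm : LinearMap.BilinForm ℂ (Cartan Γ ⊗[ℂ] H) :=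
  LinearMap.BilinForm.tmul (cartanForm q) formH

theorem loopForm_tmul (A B : Cartan Γ) (f g : H) :
    loopForm q (A ⊗ₜ f) (B ⊗ₜ g) = formH f g * cartanForm q A B := rfl

theorem loopForm_skew (x y : Cartan Γ ⊗[ℂ] H) : loopForm q x y = -loopForm q y x := by
  induction x with
  | zero => simp
  | add x x' hx hx' => simp only [map_add, LinearMap.add_apply, hx, hx', neg_add]
  | tmul A f =>
    induction y with
    | zero => simp
    | add y y' hy hy' => simp only [map_add, LinearMap.add_apply, hy, hy', neg_add]
    | tmul B g =>
      rw [loopForm_tmul, loopForm_tmul, formH_skew f g, cartanForm_symm q A B, neg_mul]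

/-- The Heisenberg Lie algebra, the central extension of `𝔥_Γ((t))` by `ℂ 𝟏`; the element `(x, c)`
is `x + c 𝟏`. -/
def Heis (_ : EvenLattice Γ) : Type _ := (Cartan Γ ⊗[ℂ] H) × ℂ

instance : AddCommGroup (Heis q) := inferInstanceAs (AddCommGroup ((Cartan Γ ⊗[ℂ] H) × ℂ))

instance : Module ℂ (Heis q) := inferInstanceAs (Module ℂ ((Cartan Γ ⊗[ℂ] H) × ℂ))

instance : Bracket (Heis q) (Heis q) := ⟨fun x y => ((0, loopForm q x.1 y.1) : _ × ℂ)⟩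

theorem Heis.bracket_def (x y : Heis q) : ⁅x, y⁆ = ((0, loopForm q x.1 y.1) : _ × ℂ) := rfl

instance : LieRing (Heis q) where
  add_lie x y z := by
    refine Prod.ext (add_zero _).symm ?_
    exact LinearMap.map_add₂ (loopForm q) x.1 y.1 z.1
  lie_add x y z := by
    refine Prod.ext (add_zero _).symm ?_
    exact map_add (loopForm q x.1) y.1 z.1
  lie_self x := by
    refine Prod.ext rfl ?_
    exact self_eq_neg.1 (loopForm_skew q x.1 x.1)
  leibniz_lie x y z := by
    refine Prod.ext (add_zero _).symm ?_
    change loopForm q x.1 0 = loopForm q 0 z.1 + loopForm q y.1 0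
    simp

instance : LieAlgebra ℂ (Heis q) where
  lie_smul c x y := by
    refine Prod.ext (smul_zero c).symm ?_
    exact map_smul (loopForm q x.1) c y.1

/-- The inclusion of vector spaces `𝔥_Γ((t)) → 𝔥̂_Γ`. -/
def Heis.loop : Cartan Γ ⊗[ℂ] H →ₗ[ℂ] Heis q := LinearMap.inl ℂ (Cartan Γ ⊗[ℂ] H) ℂ

/-- The central element `𝟏`. -/
def Heis.central : Heis q := ((0, 1) : (Cartan Γ ⊗[ℂ] H) × ℂ)

/-- The universal enveloping algebra of the Heisenberg Lie algebra. -/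
abbrev Env : Type _ := UniversalEnvelopingAlgebra ℂ (Heis q)

/-- The left ideal generated by `𝔥_Γ[[t]]` and `𝟏 - ℓ`. -/
def vacIdeal (ℓ : ℂ) : Submodule (Env q) (Env q) :=
  Submodule.span (Env q)
    ({u | ∃ (A : Cartan Γ) (f : H), f ∈ tPow 0 ∧
        u = UniversalEnvelopingAlgebra.ι ℂ (Heis.loop q (A ⊗ₜ f))} ∪
      {UniversalEnvelopingAlgebra.ι ℂ (Heis.central q) - algebraMap ℂ (Env q) ℓ})

/-- The Heisenberg vertex algebra `π_Γ^ℓ` of level `ℓ`, as a representation of the Heisenberg Lie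
algebra: it is induced from the one-dimensional representation of `𝔥_Γ[[t]] ⊕ ℂ 𝟏` on which
`𝔥_Γ[[t]]` acts by `0` and `𝟏` acts by `ℓ`. -/
abbrev Fock (ℓ : ℂ) : Type _ := Env q ⧸ vacIdeal q ℓ

/-- The vacuum vector. -/
def vac (ℓ : ℂ) : Fock q ℓ := (vacIdeal q ℓ).mkQ 1

/-- The element `A ⊗ f` for `f ∈ H'`. A class in `H'` is represented by the series without constant
term; the elements `A ⊗ b₀` are central and act by `0` on the Fock representations. -/
def mode (A : Cartan Γ) (f : H') : Env q :=
  UniversalEnvelopingAlgebra.ι ℂ (Heis.loop q (A ⊗ₜ sec f))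

/-- The vector `(A₁ ⊗ f₁) ⋯ (A_k ⊗ f_k) 𝟏` of the Fock representation. -/
def monomial (ℓ : ℂ) (l : List (Cartan Γ × H')) : Fock q ℓ :=
  (l.map fun p => mode q p.1 p.2).prod • vac q ℓ

/-! ### The action of the symplectic group -/

/-- The lift of `ρ` to `H` that preserves constant terms. -/
def liftH (ρ : SpFull) : H →ₗ[ℂ] H :=
  sec ∘ₗ ρ.1.toLinearMap ∘ₗ constLine.mkQ + (coeff 0).smulRight bZero

theorem liftH_apply (ρ : SpFull) (f : H) :
    liftH ρ f = sec (ρ.1 (constLine.mkQ f)) + coeff 0 f • bZero := rfl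

theorem mk_liftH (ρ : SpFull) (f : H) :
    constLine.mkQ (liftH ρ f) = ρ.1 (constLine.mkQ f) := by
  rw [liftH_apply, map_add, mk_sec, map_smul, mk_bZero, smul_zero, add_zero]

theorem liftH_sec (ρ : SpFull) (f : H') : liftH ρ (sec f) = sec (ρ.1 f) := by
  rw [liftH_apply, mk_sec, coeff_sec, zero_smul, add_zero]

theorem formH_liftH (ρ : SpFull) (f g : H) : formH (liftH ρ f) (liftH ρ g) = formH f g := by
  rw [← form_mk, mk_liftH, mk_liftH, ρ.2.2.2.1, form_mk]

theorem liftH_mem (ρ : SpFull) {f : H} (hf : f ∈ tPow 0) : liftH ρ f ∈ tPow 0 := by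
  have h1 : constLine.mkQ f ∈ Hplus := by
    refine ⟨_, sub_mem_tPow (mem_tPow.1 hf), ?_⟩
    rw [← sec_mk, mk_sec]
  have h2 := mem_tPow.1 (sec_mem_tPow ((ρ.2.2.2.2 _).2 h1))
  rw [mem_tPow]
  intro m hm
  rw [liftH_apply, map_add, h2 m (by omega), map_smul, coeff_bZero]
  simp [hm.ne]

theorem loopForm_liftH (ρ : SpFull) (x y : Cartan Γ ⊗[ℂ] H) :
    loopForm q ((liftH ρ).lTensor (Cartan Γ) x) ((liftH ρ).lTensor (Cartan Γ) y) =
      loopForm q x y := by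
  induction x with
  | zero => simp
  | add x x' hx hx' => simp only [map_add, LinearMap.add_apply, hx, hx']
  | tmul A f =>
    induction y with
    | zero => simp
    | add y y' hy hy' => simp only [map_add, hy, hy']
    | tmul B g =>
      rw [LinearMap.lTensor_tmul, LinearMap.lTensor_tmul, loopForm_tmul, loopForm_tmul,
        formH_liftH]

/-- The automorphism `A ⊗ f ↦ A ⊗ ρ f`, `𝟏 ↦ 𝟏` of the Heisenberg Lie algebra. -/
def heisHom (ρ : SpFull) : Heis q →ₗ⁅ℂ⁆ Heis q where
  toLinearMap := ((liftH ρ).lTensor (Cartan Γ)).prodMap (LinearMap.id : ℂ →ₗ[ℂ] ℂ)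
  map_lie' {x y} := by
    refine Prod.ext (map_zero ((liftH ρ).lTensor (Cartan Γ))) ?_
    exact (loopForm_liftH q ρ x.1 y.1).symm

theorem heisHom_loop (ρ : SpFull) (A : Cartan Γ) (f : H) :
    heisHom q ρ (Heis.loop q (A ⊗ₜ f)) = Heis.loop q (A ⊗ₜ liftH ρ f) := rfl

theorem heisHom_central (ρ : SpFull) : heisHom q ρ (Heis.central q) = Heis.central q :=
  Prod.ext (map_zero ((liftH ρ).lTensor (Cartan Γ))) rfl

attribute [local instance] LieRing.ofAssociativeRing

/-- The induced endomorphism of the enveloping algebra. -/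
def envHom (ρ : SpFull) : Env q →ₐ[ℂ] Env q :=
  UniversalEnvelopingAlgebra.lift ℂ ((UniversalEnvelopingAlgebra.ι ℂ).comp (heisHom q ρ))

theorem envHom_ι (ρ : SpFull) (x : Heis q) :
    envHom q ρ (UniversalEnvelopingAlgebra.ι ℂ x) =
      UniversalEnvelopingAlgebra.ι ℂ (heisHom q ρ x) := by
  rw [envHom, UniversalEnvelopingAlgebra.lift_ι_apply]
  rfl

theorem envHom_mode (ρ : SpFull) (A : Cartan Γ) (f : H') :
    envHom q ρ (mode q A f) = mode q A (ρ.1 f) := by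
  rw [mode, envHom_ι, heisHom_loop, liftH_sec]
  rfl

theorem envHom_vacIdeal (ρ : SpFull) (ℓ : ℂ) {u : Env q} (hu : u ∈ vacIdeal q ℓ) :
    envHom q ρ u ∈ vacIdeal q ℓ := by
  induction hu using Submodule.span_induction with
  | zero => rw [map_zero]; exact Submodule.zero_mem _
  | add x y _ _ hx hy => rw [map_add]; exact Submodule.add_mem _ hx hy
  | smul c x _ hx => rw [smul_eq_mul, map_mul]; exact Submodule.smul_mem _ _ hx
  | mem x hx =>
    apply Submodule.subset_span
    rcases hx with ⟨A, f, hf, rfl⟩ | hx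
    · exact Or.inl ⟨A, liftH ρ f, liftH_mem ρ hf, by rw [envHom_ι, heisHom_loop]⟩
    · rw [Set.mem_singleton_iff.1 hx]
      refine Or.inr ?_
      rw [map_sub, envHom_ι, heisHom_central, AlgHom.commutes]
      rfl

/-- The action of `ρ` on the Fock representation: it fixes the vacuum and satisfies
`ρ ∘ (A ⊗ f) = (A ⊗ ρ f) ∘ ρ`. -/
def fockMap (ρ : SpFull) (ℓ : ℂ) : Fock q ℓ →ₗ[ℂ] Fock q ℓ :=
  ((vacIdeal q ℓ).restrictScalars ℂ).mapQ ((vacIdeal q ℓ).restrictScalars ℂ)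
    (envHom q ρ).toLinearMap (fun _ hu => envHom_vacIdeal q ρ ℓ hu)

theorem fockMap_vac (ρ : SpFull) (ℓ : ℂ) : fockMap q ρ ℓ (vac q ℓ) = vac q ℓ :=
  congrArg (vacIdeal q ℓ).mkQ (map_one (envHom q ρ))

theorem fockMap_smul (ρ : SpFull) (ℓ : ℂ) (u : Env q) (v : Fock q ℓ) :
    fockMap q ρ ℓ (u • v) = envHom q ρ u • fockMap q ρ ℓ v := by
  obtain ⟨w, rfl⟩ := (vacIdeal q ℓ).mkQ_surjective v
  exact congrArg (vacIdeal q ℓ).mkQ (map_mul (envHom q ρ) u w)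

/-! ### Coinvariants -/

/-- The subspace `𝔥^out(V)` of `V = π_Γ^ℓ`, for `𝔥^out = 𝔥_Γ ⊗ F`. -/
def outSub (ℓ : ℂ) (F : Submodule ℂ H') : Submodule ℂ (Fock q ℓ) :=
  Submodule.span ℂ {v | ∃ (A : Cartan Γ) (f : H') (w : Fock q ℓ), f ∈ F ∧ v = mode q A f • w}

/-- The space of coinvariants `V / 𝔥^out(V)` at an extended PPAV `(Z, F, L)`. -/
abbrev ExtCoinv (ℓ : ℂ) (F : Submodule ℂ H') : Type _ := Fock q ℓ ⧸ outSub q ℓ F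

/-- The map on coinvariants induced by an automorphism `ρ` that takes `F` to `F'`. -/
def coinvMap (ρ : SpFull) (ℓ : ℂ) {F F' : Submodule ℂ H'} (h : ∀ f, ρ.1 f ∈ F' ↔ f ∈ F) :
    ExtCoinv q ℓ F →ₗ[ℂ] ExtCoinv q ℓ F' :=
  (outSub q ℓ F).mapQ (outSub q ℓ F') (fockMap q ρ ℓ) (by
    refine Submodule.span_le.2 ?_
    rintro _ ⟨A, f, w, hf, rfl⟩
    refine Submodule.subset_span ⟨A, ρ.1 f, fockMap q ρ ℓ w, (h f).2 hf, ?_⟩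
    rw [fockMap_smul, envHom_mode])

/-- The space of coinvariants `𝕍(X, Θ, π_Γ^ℓ)`, obtained by descent along `Sp(X, Θ)`: the space of
the `Sp⁺(H')`-invariant sections of the family with fibers the coinvariants at the points of the
homogeneous space `Sp(X, Θ)`. -/
def Coinv (ℓ : ℂ) {W : Type*} [NormedAddCommGroup W] [NormedSpace ℂ W] (P : PPAV W) :
    Submodule ℂ (∀ x : Sp P, ExtCoinv q ℓ x.a.F) where
  carrier := {v | ∀ ρ ∈ SpPlus, ∀ (x x' : Sp P) (h : Sp.Moves ρ x x'),
    coinvMap q ρ ℓ h.map_F (v x) = v x'}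
  add_mem' hv hw ρ hρ x x' h := by
    simp only [Pi.add_apply, map_add, hv ρ hρ x x' h, hw ρ hρ x x' h]
  zero_mem' ρ hρ x x' h := by simp only [Pi.zero_apply, map_zero]
  smul_mem' c v hv ρ hρ x x' h := by
    simp only [Pi.smul_apply, map_smul, hv ρ hρ x x' h]

/-! ### Polynomial functions -/

/-- The ring of polynomial functions on a complex vector space: the algebra of functions generated
by the linear forms. -/
def Fun (E : Type*) [AddCommGroup E] [Module ℂ E] : Subalgebra ℂ (E → ℂ) :=
  Algebra.adjoin ℂ {φ | ∃ ψ : Module.Dual ℂ E, φ = ψ}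

/-- The pairing of `𝔥_Γ ⊗ H⁰(X, Ω¹)^*` with `𝔥_Γ ⊗ H⁰(X, Ω¹)` given by
`(A ⊗ u, B ⊗ η) ↦ (A, B) u(η)`, for fixed `A` and `u`. -/
def pairing {M : Type*} [AddCommMonoid M] [Module ℂ M] (A : Cartan Γ) (u : Module.Dual ℂ M) :
    Cartan Γ ⊗[ℂ] M →ₗ[ℂ] ℂ :=
  LinearMap.mul' ℂ ℂ ∘ₗ TensorProduct.map (cartanForm q A) u

end AbelianCoinvariants

end

open AbelianCoinvariants

noncomputable section

namespace AbelianCoinvariants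

/-! ### Duality between `H'₊` and its Lagrangian complements -/

/-! At level zero the central element acts by zero, so all modes commute as operators on the Fock
space, which becomes a symmetric algebra on `𝔥_Γ ⊗ (H' / H'₊)`. Passing to coinvariants for `F`
kills the generators in `𝔥_Γ ⊗ F` and leaves `Sym(𝔥_Γ ⊗ H' / (F + H'₊))` (`coinvEquiv`). A
Lagrangian `Z` that meets `H'₊` trivially is a complement of it (`isCompl_Hplus`), so at a point `x`
of `Sp(X, Θ)` the space `H' / (F + H'₊)` is `Z / F ≅ W`. Liouville's theorem makes one-forms on `X`
constant, hence `W` is the dual of `H⁰(X, Ω¹_X)`. Every fiber is thus identified with one fixed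
symmetric algebra, compatibly with all moves `ρ x = x'` (`Sp.fiberEquiv_moves`).

Descent then reduces to two facts about `Sp(X, Θ)`: it is nonempty, and the identity component acts
transitively on it. For transitivity, `Z` and the surjection `Z → W` determine the whole point: `F`
is the kernel, and the lattice is recovered from `Λ`, `B` and the pairing of `H'₊` with `Z`
(`Sp.mem_L_iff`). It remains to move one pair `(Z, p)` to another by products of elements `1 + T`
with `T` square-zero and infinitesimally symplectic, which lie on the lines `1 + c T` and hence in
the identity component. The difference of the projections along `H'₊` moves one Lagrangian to
another; on a fixed `Z`, which is infinite-dimensional, transvections carry any surjection onto `W`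
to any other (`exists_move_surjections`). For nonemptiness, the same recipe read backwards builds an
extended PPAV from any surjection `Z → W` (`spOfSurjection`).

Uniqueness holds because products of generators span the symmetric algebra. The versions with
polynomial functions follow since a polynomial over `ℂ` is determined by its values and the form on
`𝔥_Γ` is nondegenerate. -/

/-- The monomial `t ^ m` in `H`. -/
def tMon (m : ℤ) : H := HahnSeries.single m (1 : ℂ)

theorem coeff_tMon (n m : ℤ) : coeff n (tMon m) = if n = m then 1 else 0 := by
  classical
  refine (HahnSeries.coeff_single (Γ := ℤ) (R := ℂ) (a := m) (b := n) (r := 1)).trans ?_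
  congr

theorem formH_tMon (f : H) (m : ℤ) : formH f (tMon m) = -((m : ℂ) * coeff (-m) f) := by
  rw [formH_eq_finsum, finsum_eq_single _ m]
  · simp [coeff_tMon]
  · intro n hn
    simp [coeff_tMon, hn]

theorem tMon_zero : tMon 0 = bZero := rfl

theorem H_ext {f g : H} (h : ∀ n, coeff n f = coeff n g) : f = g :=
  HahnSeries.ext (funext h)

theorem exists_mem_tPow (f : H) : ∃ N : ℕ, f ∈ tPow (1 - N) := by
  obtain ⟨b, hb⟩ : ∃ b : ℤ, ∀ m, coeff m f ≠ 0 → b ≤ m :=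
    ⟨HahnSeries.order (f : LaurentSeries ℂ), fun m hm => HahnSeries.order_le_of_coeff_ne_zero hm⟩
  refine ⟨(1 - b).toNat, mem_tPow.2 fun m hm => ?_⟩
  by_contra h
  have := hb m h
  omega

theorem mem_Hplus {x : H'} : x ∈ Hplus ↔ ∀ m < 1, coeff m (sec x) = 0 :=
  ⟨fun h => mem_tPow.1 (sec_mem_tPow h), fun h => ⟨sec x, mem_tPow.2 h, mk_sec x⟩⟩

theorem form_eq_sec (x y : H') : form x y = formH (sec x) (sec y) := by
  rw [← form_mk, mk_sec, mk_sec]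

theorem form_Hplus {x y : H'} (hx : x ∈ Hplus) (hy : y ∈ Hplus) : form x y = 0 := by
  rw [form_eq_sec, formH_eq_finsum, neg_eq_zero]
  refine (finsum_congr fun n => ?_).trans finsum_zero
  rcases lt_or_ge n 1 with h | h
  · rw [mem_Hplus.1 hy n h, mul_zero]
  · rw [mem_Hplus.1 hx (-n) (by omega), mul_zero, zero_mul]

/-- A Laurent series has finitely many terms of degree at most zero. Peeling these off one at a
time, by induction on the pole order, leaves an element of `H'₊`; no continuity of `ψ` is needed. -/
theorem dual_eq_zero (ψ : H' →ₗ[ℂ] ℂ) (h1 : ∀ x ∈ Hplus, ψ x = 0)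
    (h2 : ∀ n : ℕ, ψ (constLine.mkQ (tMon (-n))) = 0) : ψ = 0 := by
  have key : ∀ (N : ℕ) (f : H), f ∈ tPow (1 - N) → ψ (constLine.mkQ f) = 0 := by
    intro N
    induction N with
    | zero => exact fun f hf => h1 _ ⟨f, by simpa using hf, rfl⟩
    | succ N ih =>
      intro f hf
      have hf' : f - coeff (-N) f • tMon (-N) ∈ tPow (1 - N) := by
        rw [mem_tPow]
        intro m hm
        rw [map_sub, map_smul, coeff_tMon]
        by_cases h : m = -N
        · simp [h]
        · rw [if_neg h, smul_zero, sub_zero]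
          exact mem_tPow.1 hf m (by push_cast; omega)
      have h := ih _ hf'
      rwa [map_sub, map_sub, map_smul, map_smul, h2, smul_zero, sub_zero] at h
  refine LinearMap.ext fun x => ?_
  obtain ⟨f, rfl⟩ := constLine.mkQ_surjective x
  obtain ⟨N, hN⟩ := exists_mem_tPow f
  exact key N f hN

/-- Every functional on `H'` that vanishes on `H'₊` is represented by an element of `H'₊`. -/
theorem exists_form_eq (φ : H' →ₗ[ℂ] ℂ) (hφ : ∀ x ∈ Hplus, φ x = 0) :
    ∃ h ∈ Hplus, ∀ x, form h x = φ x := by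
  -- Since `⟨f, t^(-n)⟩` is `n` times the `n`-th coefficient of `f`, the prescribed values on
  -- negative powers force these coefficients.
  let c : ℤ → ℂ := fun n => if n < 1 then 0 else φ (constLine.mkQ (tMon (-n))) / n
  let f : H := HahnSeries.ofSuppBddBelow c ⟨1, fun n hn => by
    by_contra h
    exact hn (if_pos (not_le.1 h))⟩
  have hf : ∀ n, coeff n f = c n := fun n => rfl
  have hfm : f ∈ tPow 1 := mem_tPow.2 fun m hm => (hf m).trans (if_pos hm)
  have hmem : constLine.mkQ f ∈ Hplus := ⟨f, hfm, rfl⟩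
  refine ⟨_, hmem, fun x => ?_⟩
  have := dual_eq_zero (form (constLine.mkQ f) - φ) (fun x hx => ?_) (fun n => ?_)
  · exact sub_eq_zero.1 (LinearMap.congr_fun this x)
  · rw [LinearMap.sub_apply, form_Hplus hmem hx, hφ x hx, sub_zero]
  · rw [LinearMap.sub_apply, form_mk, formH_tMon, hf]
    rcases Nat.eq_zero_or_pos n with rfl | hn
    · rw [Nat.cast_zero, neg_zero, tMon_zero, mk_bZero]
      simp
    · have h1 : ¬ ((n : ℤ) < 1) := by omega
      have h2 : (n : ℂ) ≠ 0 := by exact_mod_cast hn.ne'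
      simp only [c, neg_neg, if_neg h1]
      push_cast
      field_simp
      ring

/-! ### Lagrangian complements of `H'₊` -/

section Lagrangian

variable {Z : Submodule ℂ H'}

theorem form_lagrangian (hZ : perp Z = Z) {x y : H'} (hx : x ∈ Z) (hy : y ∈ Z) : form x y = 0 :=
  (hZ.ge hy) x hx

theorem eq_zero_of_form (hZ : perp Z = Z) (hd : Z ⊓ Hplus = ⊥) {h : H'} (hh : h ∈ Hplus)
    (h0 : ∀ z ∈ Z, form h z = 0) : h = 0 := by
  have h1 : h ∈ Z := hZ.le fun z hz => by
    show form z h = 0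
    rw [form_skew, h0 z hz, neg_zero]
  exact (Submodule.eq_bot_iff _).1 hd h ⟨h1, hh⟩

/-- A functional that vanishes on `Z + H'₊` is represented by some `h` in `H'₊`. This `h` is
orthogonal to `Z`, hence lies in `Z ∩ H'₊ = 0`, so no nonzero functional kills the sum. -/
theorem isCompl_Hplus (hZ : perp Z = Z) (hd : Z ⊓ Hplus = ⊥) : IsCompl Z Hplus := by
  refine ⟨disjoint_iff.2 hd, codisjoint_iff.2 ?_⟩
  by_contra hne
  obtain ⟨x, hx⟩ : ∃ x, x ∉ Z ⊔ Hplus := by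
    by_contra! h
    exact hne (eq_top_iff.2 fun x _ => h x)
  obtain ⟨φ, h1, h2⟩ := Submodule.exists_le_ker_of_notMem hx
  obtain ⟨h, hh, hφ⟩ := exists_form_eq φ fun y hy => h2 (Submodule.mem_sup_right hy)
  refine h1 ?_
  rw [← hφ, eq_zero_of_form hZ hd hh fun z hz => (hφ z).trans (h2 (Submodule.mem_sup_left hz))]
  simp

variable (hZ : perp Z = Z) (hd : Z ⊓ Hplus = ⊥)

/-- The identification of `H'₊` with the dual of a Lagrangian complement `Z`. -/
def dualEquiv : Hplus ≃ₗ[ℂ] Module.Dual ℂ Z :=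
  LinearEquiv.ofBijective (form.domRestrict₁₂ Hplus Z) (by
    constructor
    · rw [← LinearMap.ker_eq_bot, LinearMap.ker_eq_bot']
      exact fun h hh => Subtype.ext
        (eq_zero_of_form hZ hd h.2 fun z hz => LinearMap.congr_fun hh ⟨z, hz⟩)
    · intro φ
      have hc := isCompl_Hplus hZ hd
      obtain ⟨h, hh, hφ⟩ := exists_form_eq (φ ∘ₗ Z.projectionOnto Hplus hc) fun x hx => by
        rw [LinearMap.comp_apply, (Submodule.projectionOnto_apply_eq_zero_iff hc).2 hx, map_zero]
      refine ⟨⟨h, hh⟩, LinearMap.ext fun z => (hφ z.1).trans ?_⟩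
      rw [LinearMap.comp_apply, Submodule.projectionOnto_apply_left])

theorem dualEquiv_apply (h : Hplus) (z : Z) : dualEquiv hZ hd h z = form h.1 z.1 := rfl

theorem form_dualEquiv_symm (φ : Module.Dual ℂ Z) (z : Z) :
    form ((dualEquiv hZ hd).symm φ).1 z.1 = φ z := by
  rw [← dualEquiv_apply hZ hd, LinearEquiv.apply_symm_apply]

end Lagrangian

/-- The standard Lagrangian complement `t⁻¹ ℂ[t⁻¹]` of `H'₊`. -/
def Hminus : Submodule ℂ H' := ⨅ m : {m : ℤ // 0 < m}, LinearMap.ker (coeff m ∘ₗ sec)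

theorem mem_Hminus {x : H'} : x ∈ Hminus ↔ ∀ m, 0 < m → coeff m (sec x) = 0 := by
  simp [Hminus, Submodule.mem_iInf]

theorem tMon_mem_Hminus (n : ℕ) : constLine.mkQ (tMon (-n)) ∈ Hminus := by
  rw [mem_Hminus]
  intro m hm
  rw [sec_mk, map_sub, map_smul, coeff_tMon, coeff_bZero, if_neg (by omega), if_neg hm.ne']
  simp

theorem perp_Hminus : perp Hminus = Hminus := by
  ext x
  constructor
  · intro hx
    rw [mem_Hminus]
    intro m hm
    obtain ⟨n, rfl⟩ := Int.eq_ofNat_of_zero_le hm.le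
    have h : form (constLine.mkQ (tMon (-n))) x = 0 := hx _ (tMon_mem_Hminus n)
    rw [← mk_sec x, form_mk, formH_skew, formH_tMon] at h
    have hn : n ≠ 0 := by omega
    simpa [hn] using h
  · intro hx y hy
    show form y x = 0
    rw [form_eq_sec, formH_eq_finsum, neg_eq_zero]
    refine (finsum_congr fun n => ?_).trans finsum_zero
    rcases lt_trichotomy n 0 with h | rfl | h
    · rw [mem_Hminus.1 hy (-n) (by omega), mul_zero, zero_mul]
    · simp
    · rw [mem_Hminus.1 hx n h, mul_zero]

theorem Hminus_inf_Hplus : Hminus ⊓ Hplus = ⊥ := by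
  refine (Submodule.eq_bot_iff _).2 fun x hx => ?_
  rw [← mk_sec x, show sec x = 0 from H_ext fun n => ?_, map_zero]
  rcases lt_or_ge n 1 with h | h
  · rw [mem_Hplus.1 hx.2 n h, map_zero]
  · rw [mem_Hminus.1 hx.1 n (by omega), map_zero]

/-! ### Unipotent elements of the identity component -/

theorem filt_anti {m n : ℤ} (h : m ≤ n) : filt n ≤ filt m :=
  Submodule.map_mono fun _ hf => mem_tPow.2 fun k hk => mem_tPow.1 hf k (hk.trans_le h)

theorem coeff_sec_of_mem_filt {n : ℤ} (hn : 1 ≤ n) {x : H'} (hx : x ∈ filt n) {m : ℤ}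
    (hm : m < n) : coeff m (sec x) = 0 := by
  obtain ⟨f, hf, rfl⟩ := hx
  rw [sec_mk, map_sub, map_smul, mem_tPow.1 hf m hm, mem_tPow.1 hf 0 (by omega)]
  simp

/-- Pairing with `t^(-k)` reads off the `k`-th coefficient up to the factor `k`, so finitely many
pairings control the `t`-adic order. -/
theorem mem_filt_of_form {n : ℕ} {x : H'} (hx : x ∈ Hplus)
    (h : ∀ k : ℕ, k < n → form x (constLine.mkQ (tMon (-k))) = 0) : x ∈ filt n := by
  refine ⟨sec x, mem_tPow.2 fun m hm => ?_, mk_sec x⟩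
  rcases lt_or_ge m 1 with h1 | h1
  · exact mem_Hplus.1 hx m h1
  · obtain ⟨k, rfl⟩ := Int.eq_ofNat_of_zero_le (by omega : 0 ≤ m)
    have hk := h k (by exact_mod_cast hm)
    rw [← mk_sec x, form_mk, formH_tMon] at hk
    have hk0 : k ≠ 0 := by omega
    simpa [hk0] using hk

/-- The pole of `y` is finite, so high powers of `t` pair to zero with it. The `+ 1` keeps the index
positive, where discarding the constant term loses nothing. -/
theorem exists_filt_form_eq_zero (y : H') : ∃ M : ℕ, ∀ x ∈ filt (M + 1), form x y = 0 := by
  obtain ⟨M, hM⟩ := exists_mem_tPow (sec y)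
  refine ⟨M, fun x hx => ?_⟩
  rw [form_eq_sec, formH_eq_finsum, neg_eq_zero]
  refine (finsum_congr fun n => ?_).trans finsum_zero
  rcases lt_or_ge n (1 - M) with h | h
  · rw [mem_tPow.1 hM n h, mul_zero]
  · rw [coeff_sec_of_mem_filt (by omega) hx (by omega), mul_zero, zero_mul]

/-- An infinitesimally symplectic endomorphism that preserves `H'₊` is continuous. -/
theorem tAdicContinuous_of_skew {T : H' →ₗ[ℂ] H'} (hT : ∀ x y, form (T x) y = -form x (T y))
    (hp : ∀ x ∈ Hplus, T x ∈ Hplus) : TAdicContinuous T := by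
  intro n
  -- The order of `T x` is tested by its pairings with finitely many `t^(-k)`; skewness turns them
  -- into pairings of `x` with the fixed vectors `T (t^(-k))`, which vanish once `x` is deep enough
  -- in the filtration.
  choose M hM using fun k : ℕ => exists_filt_form_eq_zero (T (constLine.mkQ (tMon (-k))))
  refine ⟨((Finset.range n.toNat).sup M : ℕ) + 1, fun x hx => ?_⟩
  refine filt_anti (Int.self_le_toNat n) (mem_filt_of_form (hp x (filt_anti (by omega) hx)) ?_)
  intro k hk
  rw [hT, hM k x, neg_zero]
  have := Finset.le_sup (f := M) (Finset.mem_range.2 hk)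
  exact filt_anti (by omega) hx

theorem tAdicContinuous_id_add {T : H' →ₗ[ℂ] H'} (hT : TAdicContinuous T) (c : ℂ) :
    TAdicContinuous (LinearMap.id + c • T) := by
  intro n
  obtain ⟨m, hm⟩ := hT n
  refine ⟨max m n, fun x hx => Submodule.add_mem _ (filt_anti (le_max_right m n) hx) ?_⟩
  exact Submodule.smul_mem _ c (hm (filt_anti (le_max_left m n) hx))

/-- An endomorphism of `H'` whose exponential `1 + T` lies in the symplectic group. -/
structure IsNilSymp (T : H' →ₗ[ℂ] H') : Prop where
  skew : ∀ x y, form (T x) y = -form x (T y)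
  sq : ∀ x, T (T x) = 0
  plus : ∀ x ∈ Hplus, T x ∈ Hplus

namespace IsNilSymp

variable {T : H' →ₗ[ℂ] H'} (hT : IsNilSymp T)

/-- The automorphism `1 + c T`. -/
def equiv (c : ℂ) : H' ≃ₗ[ℂ] H' :=
  LinearEquiv.ofLinearMap (LinearMap.id + c • T) (LinearMap.id + (-c) • T)
    (LinearMap.ext fun x => by simp [hT.sq])
    (LinearMap.ext fun x => by simp [hT.sq])

theorem equiv_apply (c : ℂ) (x : H') : hT.equiv c x = x + c • T x := rfl

/-- The one-parameter group `1 + c T` in the symplectic group. -/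
def toSp (c : ℂ) : SpFull := ⟨hT.equiv c, by
  have hc := tAdicContinuous_of_skew hT.skew hT.plus
  refine ⟨tAdicContinuous_id_add hc c, tAdicContinuous_id_add hc (-c), fun x y => ?_, fun x => ?_⟩
  · simp [equiv_apply, hT.skew x, hT.sq]
  · have h (c : ℂ) (x : H') (hx : x ∈ Hplus) : x + c • T x ∈ Hplus :=
      Submodule.add_mem _ hx (Submodule.smul_mem _ c (hT.plus x hx))
    refine ⟨fun hx => ?_, h c x⟩
    have := h (-c) _ hx
    simpa [equiv_apply, hT.sq] using this⟩

theorem toSp_apply (c : ℂ) (x : H') : (hT.toSp c).1 x = x + c • T x := rfl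

theorem continuous_toSp : Continuous hT.toSp := by
  refine continuous_induced_rng.2 (continuous_pi fun p => ?_)
  have : (fun c => form ((hT.toSp c).1 p.1) p.2) =
      fun c => form p.1 p.2 + c * form (T p.1) p.2 := by
    funext c
    simp [toSp_apply]
  change Continuous fun c => form ((hT.toSp c).1 p.1) p.2
  rw [this]
  fun_prop

/-- The matrix coefficients are affine in `c`, so the line `c ↦ 1 + c T` is a connected set through
the identity. -/
theorem toSp_mem (c : ℂ) : hT.toSp c ∈ SpPlus := by
  have h0 : hT.toSp 0 = 1 := Subtype.ext (LinearEquiv.ext fun x => by simp [toSp_apply])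
  refine (isPreconnected_range hT.continuous_toSp).subset_connectedComponent ?_ ⟨c, rfl⟩
  exact ⟨0, h0⟩

end IsNilSymp

/-- Continuity of right translation suffices: the coefficient of `τ σ` at `(f, g)` is that of `τ` at
`(σ f, g)`. Translating the component of `1` by `σ` gives a connected set that contains `σ`. -/
theorem SpPlus_mul {ρ σ : SpFull} (hρ : ρ ∈ SpPlus) (hσ : σ ∈ SpPlus) : ρ * σ ∈ SpPlus := by
  have hc : Continuous fun τ : SpFull => τ * σ := by
    refine continuous_induced_rng.2 (continuous_pi fun p => ?_)
    have h : Continuous fun (τ : SpFull) (p : H' × H') => form (τ.1 p.1) p.2 :=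
      continuous_induced_dom
    exact (continuous_apply (σ.1 p.1, p.2)).comp h
  have h1 := (isPreconnected_connectedComponent (x := (1 : SpFull))).image _ hc.continuousOn
  have h2 := h1.subset_connectedComponent (x := σ) ⟨1, mem_connectedComponent, one_mul σ⟩
  rw [← connectedComponent_eq hσ] at h2
  exact h2 ⟨ρ, hρ, rfl⟩

/-- Any two Lagrangian complements of `H'₊` are related by the identity component. -/
theorem exists_move_lagrangian {Z : Submodule ℂ H'} (hZ : perp Z = Z) (hd : Z ⊓ Hplus = ⊥)
    {Z' : Submodule ℂ H'} (hZ' : perp Z' = Z') (hd' : Z' ⊓ Hplus = ⊥) :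
    ∃ ρ ∈ SpPlus, ∀ z ∈ Z, ρ.1 z ∈ Z' := by
  have hc := isCompl_Hplus hZ hd
  have hc' := isCompl_Hplus hZ' hd'
  set π := Z.projection Hplus hc with hπ
  set π' := Z'.projection Hplus hc' with hπ'
  have m (x) : π x ∈ Z := (Z.projectionOnto Hplus hc x).2
  have mem' (x) : π' x ∈ Z' := (Z'.projectionOnto Hplus hc' x).2
  have z (x) (hx : x ∈ Hplus) : π x = 0 := Submodule.projection_apply_of_mem_right hc hx
  have z' (x) (hx : x ∈ Hplus) : π' x = 0 := Submodule.projection_apply_of_mem_right hc' hx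
  have s (x) : x - π x ∈ Hplus := by
    rw [← Submodule.projectionOnto_apply_eq_zero_iff hc, map_sub, sub_eq_zero]
    exact (Submodule.projectionOnto_apply_left hc _).symm
  have s' (x) : x - π' x ∈ Hplus := by
    rw [← Submodule.projectionOnto_apply_eq_zero_iff hc', map_sub, sub_eq_zero]
    exact (Submodule.projectionOnto_apply_left hc' _).symm
  have t (x) : (π' - π) x ∈ Hplus := by
    have := Submodule.sub_mem _ (s x) (s' x)
    simpa using this
  -- The difference of the two projections kills `H'₊` and has image in it, hence squares to zero;
  -- adding it to the identity turns `π` into `π'` on `Z`. Skewness uses that `Z`, `Z'` and `H'₊`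
  -- are all isotropic.
  have hT : IsNilSymp (π' - π) := by
    refine ⟨fun x y => ?_, fun x => ?_, fun x _ => t x⟩
    · have h1 := form_Hplus (t x) (s y)
      have h2 := form_Hplus (s' x) (t y)
      have h3 := form_lagrangian hZ (m x) (m y)
      have h4 := form_lagrangian hZ' (mem' x) (mem' y)
      simp only [map_sub, LinearMap.sub_apply] at h1 h2 ⊢
      linear_combination h1 + h2 + h4 - h3
    · rw [LinearMap.sub_apply, z' _ (t x), z _ (t x), sub_zero]
  refine ⟨hT.toSp 1, hT.toSp_mem 1, fun x hx => ?_⟩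
  have : π x = x := Submodule.projection_apply_left hc ⟨x, hx⟩
  rw [hT.toSp_apply, one_smul, LinearMap.sub_apply, this, add_sub_cancel]
  exact mem' x

/-- A square-zero endomorphism of a Lagrangian complement of `H'₊` exponentiates to an element of
the identity component. -/
theorem exists_unipotent {Z : Submodule ℂ H'} (hZ : perp Z = Z) (hd : Z ⊓ Hplus = ⊥)
    (N : Z →ₗ[ℂ] Z) (hN : ∀ z, N (N z) = 0) :
    ∃ ρ ∈ SpPlus, ∀ z : Z, ρ.1 z.1 = (z + N z : Z) := by
  have hc := isCompl_Hplus hZ hd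
  let D := dualEquiv hZ hd
  -- `N'` is the transpose of `N` under the duality of `H'₊` with `Z`. The operator `N` on `Z` and
  -- `-N'` on `H'₊` is then infinitesimally symplectic.
  let N' : Hplus →ₗ[ℂ] Hplus := D.symm.toLinearMap ∘ₗ N.dualMap ∘ₗ D.toLinearMap
  have hN' (h : Hplus) (z : Z) : form (N' h).1 z.1 = form h.1 (N z).1 :=
    form_dualEquiv_symm hZ hd _ z
  let e := Z.prodEquivOfIsCompl Hplus hc
  let T : H' →ₗ[ℂ] H' := e.toLinearMap ∘ₗ (N.prodMap (-N')) ∘ₗ e.symm.toLinearMap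
  have hT (z : Z) (h : Hplus) : T (z.1 + h.1) = (N z).1 - (N' h).1 := by
    have : z.1 + h.1 = e (z, h) := rfl
    simp only [T, LinearMap.comp_apply, this, LinearEquiv.coe_coe, LinearEquiv.symm_apply_apply]
    simp [e, sub_eq_add_neg]
  have hdec (x : H') : ∃ (z : Z) (h : Hplus), x = z.1 + h.1 :=
    ⟨(e.symm x).1, (e.symm x).2, (e.apply_symm_apply x).symm⟩
  have hTZ (z : Z) : T z.1 = (N z).1 := by simpa using hT z 0
  have hTp (h : Hplus) : T h.1 = -(N' h).1 := by simpa using hT 0 h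
  have hNN (h : Hplus) : N' (N' h) = 0 := Subtype.ext <|
    eq_zero_of_form hZ hd (N' (N' h)).2 fun z hz => by
      rw [hN' _ ⟨z, hz⟩, hN', hN, Submodule.coe_zero, map_zero]
  have hnil : IsNilSymp T := by
    refine ⟨fun x y => ?_, fun x => ?_, fun x hx => ?_⟩
    · obtain ⟨z, h, rfl⟩ := hdec x
      obtain ⟨z', h', rfl⟩ := hdec y
      rw [hT, hT]
      have h1 := form_lagrangian hZ (N z).2 z'.2
      have h2 := form_lagrangian hZ z.2 (N z').2
      have h3 := form_Hplus (N' h).2 h'.2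
      have h4 := form_Hplus h.2 (N' h').2
      have h5 := form_skew (N z).1 h'.1
      have h6 := form_skew z.1 (N' h').1
      have h7 := hN' h z'
      have h8 := hN' h' z
      simp only [map_sub, map_add, LinearMap.sub_apply, LinearMap.add_apply]
      linear_combination h1 + h2 - h3 - h4 + h5 - h6 - h7 + h8
    · obtain ⟨z, h, rfl⟩ := hdec x
      rw [hT, map_sub, hTZ, hTp, hN, hNN]
      simp
    · have := (-(N' ⟨x, hx⟩)).2
      rwa [Submodule.coe_neg, ← hTp] at this
  refine ⟨hnil.toSp 1, hnil.toSp_mem 1, fun z => ?_⟩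
  rw [hnil.toSp_apply, one_smul, hTZ]
  rfl

/-! ### Transitivity on surjections from a Lagrangian complement -/

theorem not_finite_Hplus : ¬ Module.Finite ℂ Hplus := by
  intro hfin
  let c : Hplus →ₗ[ℂ] ℕ → ℂ := LinearMap.pi fun k => coeff (k + 1) ∘ₗ sec ∘ₗ Hplus.subtype
  have hmem (k : ℕ) : constLine.mkQ (tMon (k + 1)) ∈ Hplus :=
    ⟨_, mem_tPow.2 fun m hm => by rw [coeff_tMon, if_neg (by omega)], rfl⟩
  have hli : LinearIndependent ℂ fun k : ℕ => (⟨_, hmem k⟩ : Hplus) := by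
    refine LinearIndependent.of_comp c ?_
    have : (c ∘ fun k : ℕ => (⟨_, hmem k⟩ : Hplus)) = fun k => Pi.single k 1 := by
      funext k l
      change coeff (l + 1) (sec (constLine.mkQ (tMon (k + 1)))) = _
      rw [sec_mk, map_sub, map_smul, coeff_tMon, coeff_tMon, if_neg (by omega : (0 : ℤ) ≠ k + 1),
        zero_smul, sub_zero, Pi.single_apply]
      simp
    rw [this]
    exact Pi.linearIndependent_single_one ℕ ℂ
  exact not_finite_iff_infinite.2 inferInstance hli.finite

/-- The dual of `Z` is `H'₊`, which contains all positive powers of `t`. -/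
theorem not_finite_lagrangian {Z : Submodule ℂ H'} (hZ : perp Z = Z) (hd : Z ⊓ Hplus = ⊥) :
    ¬ Module.Finite ℂ Z := by
  intro h
  exact not_finite_Hplus (Module.Finite.equiv (dualEquiv hZ hd).symm)

theorem exists_injective_of_not_finite {W V : Type*} [AddCommGroup W] [Module ℂ W]
    [FiniteDimensional ℂ W] [AddCommGroup V] [Module ℂ V] (hV : ¬ Module.Finite ℂ V) :
    ∃ j : W →ₗ[ℂ] V, Function.Injective j := by
  have h : (Module.finrank ℂ W : Cardinal) ≤ Module.rank ℂ V :=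
    Cardinal.natCast_lt_aleph0.le.trans (not_lt.1 fun h => hV (Module.rank_lt_aleph0_iff.1 h))
  obtain ⟨f, hf⟩ := (Module.le_rank_iff_exists_linearMap).1 h
  let e := (Module.finBasis ℂ W).equivFun
  exact ⟨f ∘ₗ e.toLinearMap, hf.comp e.injective⟩

section Lagrangian

variable {Z : Submodule ℂ H'}

/-- With `p` and `r` as independent coordinates, `1 - i r` replaces `p` by `p - r` and fixes `r`;
then `1 + j p` adds the new `p` to `r`, which becomes the old `p`. The four relations make both `i
r` and `j p` square-zero. -/
theorem exists_move_of_dual_pairs {W : Type*} [AddCommGroup W] [Module ℂ W]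
    (hZ : perp Z = Z) (hd : Z ⊓ Hplus = ⊥) {p r : Z →ₗ[ℂ] W} {i j : W →ₗ[ℂ] Z}
    (hpi : ∀ w, p (i w) = w) (hpj : ∀ w, p (j w) = 0)
    (hri : ∀ w, r (i w) = 0) (hrj : ∀ w, r (j w) = w) :
    ∃ ρ ∈ SpPlus, ∀ z : Z, ∃ z' : Z, ρ.1 z.1 = z'.1 ∧ r z' = p z := by
  obtain ⟨ρ₁, h₁, e₁⟩ := exists_unipotent hZ hd (-(i ∘ₗ r)) fun z => by simp [hri]
  obtain ⟨ρ₂, h₂, e₂⟩ := exists_unipotent hZ hd (j ∘ₗ p) fun z => by simp [hpj]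
  refine ⟨ρ₂ * ρ₁, SpPlus_mul h₂ h₁, fun z => ⟨_, (congrArg ρ₂.1 (e₁ z)).trans (e₂ _), ?_⟩⟩
  simp [hpi, hri, hrj]

/-- In general `p` and `p'` are not independent coordinates. An auxiliary surjection `r` independent
of both is interposed, and `p` is exchanged with `r`, then `r` with `p'`. -/
theorem exists_move_surjections {W : Type*} [AddCommGroup W] [Module ℂ W] [FiniteDimensional ℂ W]
    (hZ : perp Z = Z) (hd : Z ⊓ Hplus = ⊥) {p p' : Z →ₗ[ℂ] W}
    (hp : Function.Surjective p) (hp' : Function.Surjective p') :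
    ∃ ρ ∈ SpPlus, ∀ z : Z, ∃ z' : Z, ρ.1 z.1 = z'.1 ∧ p' z' = p z := by
  -- The common kernel of `p` and `p'` has finite codimension in the infinite-dimensional `Z`, so it
  -- contains a copy of `W`; a left inverse of that embedding serves as `r`.
  have hG : ¬ Module.Finite ℂ (LinearMap.ker (p.prod p')) := by
    intro h
    have : Module.Finite ℂ (Z ⧸ LinearMap.ker (p.prod p')) :=
      Module.Finite.equiv (p.prod p').quotKerEquivRange.symm
    exact not_finite_lagrangian hZ hd
      (Module.Finite.of_submodule_quotient (LinearMap.ker (p.prod p')))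
  obtain ⟨k, hk⟩ := exists_injective_of_not_finite (W := W) (V := LinearMap.ker (p.prod p')) hG
  set j : W →ₗ[ℂ] Z := (LinearMap.ker (p.prod p')).subtype ∘ₗ k with hj
  have hpj (w) : p (j w) = 0 := congrArg Prod.fst (LinearMap.mem_ker.1 (k w).2)
  have hpj' (w) : p' (j w) = 0 := congrArg Prod.snd (LinearMap.mem_ker.1 (k w).2)
  obtain ⟨r, hr⟩ := j.exists_leftInverse_of_injective
    (LinearMap.ker_eq_bot.2 ((Submodule.subtype_injective _).comp hk))
  have hrj (w) : r (j w) = w := LinearMap.congr_fun hr w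
  obtain ⟨s, hs⟩ := p.exists_rightInverse_of_surjective (LinearMap.range_eq_top.2 hp)
  obtain ⟨s', hs'⟩ := p'.exists_rightInverse_of_surjective (LinearMap.range_eq_top.2 hp')
  have hps (w) : p (s w) = w := LinearMap.congr_fun hs w
  have hps' (w) : p' (s' w) = w := LinearMap.congr_fun hs' w
  -- The sections of `p` and `p'` are corrected by elements of the common kernel so that `r`
  -- vanishes on them.
  obtain ⟨ρ, h, e⟩ := exists_move_of_dual_pairs hZ hd (p := p) (r := r) (i := s - j ∘ₗ r ∘ₗ s)
    (j := j) (by simp [hps, hpj]) hpj (by simp [hrj]) hrj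
  obtain ⟨ρ', h', e'⟩ := exists_move_of_dual_pairs hZ hd (p := r) (r := p') (i := j)
    (j := s' - j ∘ₗ r ∘ₗ s') hrj (by simp [hrj]) hpj' (by simp [hps', hpj'])
  refine ⟨ρ' * ρ, SpPlus_mul h' h, fun z => ?_⟩
  obtain ⟨z₁, a₁, b₁⟩ := e z
  obtain ⟨z₂, a₂, b₂⟩ := e' z₁
  exact ⟨z₂, (congrArg ρ'.1 a₁).trans a₂, b₂.trans b₁⟩

end Lagrangian

/-! ### Transitivity on `Sp(X, Θ)` -/

theorem redForm_mkQ (F : Submodule ℂ H') (f g : perp F) :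
    redForm F ((F.submoduleOf _).mkQ f) ((F.submoduleOf _).mkQ g) = form f.1 g.1 := rfl

section

variable {W : Type*} [NormedAddCommGroup W] [NormedSpace ℂ W] {P : PPAV W}

namespace Sp

theorem isCompl (x : Sp P) : IsCompl x.a.Z Hplus :=
  isCompl_Hplus x.a.lagrangian x.a.disjoint_plus

theorem exists_add (x : Sp P) (f : H') : ∃ (z : x.a.Z) (k : H'), k ∈ Hplus ∧ f = z.1 + k := by
  have : f ∈ x.a.Z ⊔ Hplus := x.isCompl.sup_eq_top ▸ Submodule.mem_top
  obtain ⟨z, hz, k, hk, rfl⟩ := Submodule.mem_sup.1 this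
  exact ⟨⟨z, hz⟩, k, hk, rfl⟩

/-- The composition `Z → Z / F ≅ W`. -/
def proj (x : Sp P) : x.a.Z →ₗ[ℂ] W := x.iso.toLinearMap ∘ₗ (x.a.F.submoduleOf x.a.Z).mkQ

theorem proj_surjective (x : Sp P) : Function.Surjective x.proj :=
  x.iso.surjective.comp (Submodule.mkQ_surjective _)

theorem proj_eq_zero (x : Sp P) (z : x.a.Z) : x.proj z = 0 ↔ z.1 ∈ x.a.F := by
  change x.iso ((x.a.F.submoduleOf x.a.Z).mkQ z) = 0 ↔ _
  rw [LinearEquiv.map_eq_zero_iff, Submodule.mkQ_apply, Submodule.Quotient.mk_eq_zero]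
  rfl

theorem le_perp (x : Sp P) : x.a.Z ≤ perp x.a.F :=
  AbelianCoinvariants.le_perp x.a.F_le x.a.lagrangian

theorem incl_mk (x : Sp P) (z : x.a.Z) : x.a.incl ((x.a.F.submoduleOf _).mkQ z) =
    (x.a.F.submoduleOf _).mkQ ⟨z.1, x.le_perp z.2⟩ := rfl

/-- If `u'` is the conjugate of `u` given by `conj_plus`, both `u + p` and `u + u'` are real. Their
difference `p - u'` is real and lies in `F^⊥₊`, hence is zero. -/
theorem isConj_of_mem (x : Sp P) {u : x.a.Tangent} {p : Red x.a.F} (hp : p ∈ redPlus x.a.F)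
    (h : x.a.incl u + p ∈ x.a.L) : IsConj x.a.L (x.a.incl u) p := by
  obtain ⟨u', hu', y, hy, y', hy', h1, h2⟩ := x.a.conj_plus u
  have h3 : p - u' = 0 := by
    refine x.a.disjoint_real _ ?_ (Submodule.sub_mem _ hp hu')
    have h1' : x.a.incl u = y + Complex.I • y' := h1
    have : p - u' = (x.a.incl u + p) - (y + y) := by rw [h1', h2]; abel
    rw [this]
    exact Submodule.sub_mem _ (Submodule.subset_span h) (Submodule.add_mem _ hy hy)
  rw [sub_eq_zero.1 h3]
  exact ⟨y, hy, y', hy', h1, h2⟩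

/-- The `H'₊` part of a lattice vector is the conjugate of its `Z / F` part, and the Hermitian form
prescribes the pairing of this conjugate with `Z`. So `L` can be read off from `Z`, the map `Z → W`
and `(Λ, B)`, which reduces transitivity to moving `Z` and that map. -/
theorem mem_L_iff (x : Sp P) (z : x.a.Z) (h : H') (hh : h ∈ Hplus) (f : perp x.a.F)
    (hf : f.1 = z.1 + h) :
    (x.a.F.submoduleOf _).mkQ f ∈ x.a.L ↔
      x.proj z ∈ P.Λ ∧ ∀ v : x.a.Z, form h v.1 = Real.pi * P.B (x.proj z) (x.proj v) := by
  have hhF : h ∈ perp x.a.F := by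
    have := Submodule.sub_mem _ f.2 (x.le_perp z.2)
    rwa [hf, add_sub_cancel_left] at this
  set p : Red x.a.F := (x.a.F.submoduleOf _).mkQ ⟨h, hhF⟩ with hp
  have hpm : p ∈ redPlus x.a.F := ⟨⟨h, hhF⟩, hh, rfl⟩
  have hmk : (x.a.F.submoduleOf _).mkQ f = x.a.incl ((x.a.F.submoduleOf _).mkQ z) + p := by
    rw [incl_mk, hp, ← map_add]
    exact congrArg _ (Subtype.ext hf)
  have hpi : (Real.pi : ℂ) ≠ 0 := by exact_mod_cast Real.pi_ne_zero
  have key (k : H') (hk : k ∈ perp x.a.F) (hk' : k ∈ Hplus)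
      (hL : x.a.incl ((x.a.F.submoduleOf _).mkQ z) + (x.a.F.submoduleOf _).mkQ ⟨k, hk⟩ ∈ x.a.L)
      (v : x.a.Z) : form k v.1 = Real.pi * P.B (x.proj z) (x.proj v) := by
    have hc := x.isConj_of_mem ⟨⟨k, hk⟩, hk', rfl⟩ hL
    have := x.iso_form _ ((x.a.F.submoduleOf _).mkQ v) _ hc
    rw [incl_mk, redForm_mkQ] at this
    change P.B (x.proj z) (x.proj v) = _ at this
    rw [this]
    field_simp
  rw [hmk]
  constructor
  · exact fun hL => ⟨(x.iso_lattice _).2 ⟨p, hpm, hL⟩, key h hhF hh hL⟩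
  · rintro ⟨h1, h2⟩
    -- Over a point of `Λ` there is some lattice vector, with `H'₊` part `k`. Both `h` and `k` have
    -- the prescribed pairings with `Z`, so they agree by duality.
    obtain ⟨_, ⟨⟨k, hk⟩, hk', rfl⟩, hL⟩ := (x.iso_lattice ((x.a.F.submoduleOf _).mkQ z)).1 h1
    have : h - k = 0 := eq_zero_of_form x.a.lagrangian x.a.disjoint_plus
      (Submodule.sub_mem _ hh hk') fun v hv => by
        rw [map_sub, LinearMap.sub_apply, h2 ⟨v, hv⟩, key k hk hk' hL ⟨v, hv⟩, sub_self]
    obtain rfl := sub_eq_zero.1 this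
    exact hL

/-- `F` is the kernel of the map to `W`, and `L` is determined through `mem_L_iff`, whose conditions
are transported because `ρ` preserves the form and `H'₊`. -/
theorem moves_of_proj {x x' : Sp P} {ρ : SpFull}
    (h : ∀ z : x.a.Z, ∃ z' : x'.a.Z, ρ.1 z.1 = z'.1 ∧ x'.proj z' = x.proj z) : Moves ρ x x' := by
  have hproj (z : x.a.Z) (z' : x'.a.Z) (e : z'.1 = ρ.1 z.1) : x'.proj z' = x.proj z := by
    obtain ⟨y, h1, h2⟩ := h z
    rw [← h2]
    exact congrArg _ (Subtype.ext (e.trans h1))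
  have hmapZ (f : H') : ρ.1 f ∈ x'.a.Z ↔ f ∈ x.a.Z := by
    constructor
    · intro hf
      obtain ⟨z, k, hk, rfl⟩ := x.exists_add f
      obtain ⟨z', h1, -⟩ := h z
      have h2 : ρ.1 k ∈ x'.a.Z := by
        rw [map_add, h1] at hf
        exact (Submodule.add_mem_iff_right _ z'.2).1 hf
      have h3 : ρ.1 k = 0 := (Submodule.eq_bot_iff _).1 x'.a.disjoint_plus _
        ⟨h2, (ρ.2.2.2.2 k).2 hk⟩
      rw [(LinearEquiv.map_eq_zero_iff _).1 h3, add_zero]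
      exact z.2
    · intro hf
      obtain ⟨z', h1, -⟩ := h ⟨f, hf⟩
      exact h1 ▸ z'.2
  refine ⟨hmapZ, fun f => ?_, fun f f' e => ?_, hproj⟩
  · constructor
    · intro hf
      have hfZ := (hmapZ f).1 (x'.a.F_le hf)
      rw [← x.proj_eq_zero ⟨f, hfZ⟩, ← hproj ⟨f, hfZ⟩ ⟨_, x'.a.F_le hf⟩ rfl]
      exact (x'.proj_eq_zero _).2 hf
    · intro hf
      have hfZ := (hmapZ f).2 (x.a.F_le hf)
      rw [← x'.proj_eq_zero ⟨_, hfZ⟩, hproj ⟨f, x.a.F_le hf⟩ ⟨_, hfZ⟩ rfl]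
      exact (x.proj_eq_zero _).2 hf
  · obtain ⟨z, k, hk, hf⟩ := x.exists_add f.1
    obtain ⟨z', h1, h2⟩ := h z
    have hf' : f'.1 = z'.1 + ρ.1 k := by rw [e, hf, map_add, h1]
    rw [x.mem_L_iff z k hk f hf, x'.mem_L_iff z' (ρ.1 k) ((ρ.2.2.2.2 k).2 hk) f' hf', h2]
    refine and_congr_right fun _ => ⟨fun hv v => ?_, fun hv v => ?_⟩
    · obtain ⟨v', h3, h4⟩ := h v
      rw [← h4, ← hv, ← h3, ρ.2.2.2.1]
    · obtain ⟨w, hw⟩ := ρ.1.surjective v.1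
      have hwZ : w ∈ x.a.Z := (hmapZ w).1 (hw ▸ v.2)
      rw [hproj ⟨w, hwZ⟩ v hw.symm, ← hv ⟨w, hwZ⟩, ← hw, ρ.2.2.2.1]

/-- The identity component of the symplectic group acts transitively on `Sp(X, Θ)`. -/
theorem exists_moves [FiniteDimensional ℂ W] (x x' : Sp P) : ∃ ρ ∈ SpPlus, Moves ρ x x' := by
  obtain ⟨ρ, hρ, h⟩ := exists_move_lagrangian x.a.lagrangian x.a.disjoint_plus
    x'.a.lagrangian x'.a.disjoint_plus
  have hsurj (z' : x'.a.Z) : ∃ z ∈ x.a.Z, ρ.1 z = z'.1 := by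
    obtain ⟨f, hf⟩ := ρ.1.surjective z'.1
    obtain ⟨z, k, hk, rfl⟩ := x.exists_add f
    refine ⟨z, z.2, ?_⟩
    have h2 : ρ.1 k ∈ x'.a.Z := by
      have := z'.2
      rw [← hf, map_add] at this
      exact (Submodule.add_mem_iff_right _ (h z z.2)).1 this
    have h3 : ρ.1 k = 0 := (Submodule.eq_bot_iff _).1 x'.a.disjoint_plus _
      ⟨h2, (ρ.2.2.2.2 k).2 hk⟩
    rw [← hf, map_add, h3, add_zero]
  let R : x.a.Z →ₗ[ℂ] x'.a.Z := ρ.1.toLinearMap.restrict h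
  have hR (z : x.a.Z) : (R z).1 = ρ.1 z.1 := rfl
  let e : x.a.Z ≃ₗ[ℂ] x'.a.Z := LinearEquiv.ofBijective R
    ⟨fun a b hab => Subtype.ext (ρ.1.injective (congrArg Subtype.val hab)), fun z' => by
      obtain ⟨z, hz, h1⟩ := hsurj z'
      exact ⟨⟨z, hz⟩, Subtype.ext h1⟩⟩
  -- `ρ` has matched the Lagrangians; the surjection of `x`, transported to the second Lagrangian,
  -- is now compared with that of `x'`.
  obtain ⟨σ, hσ, h'⟩ := exists_move_surjections x'.a.lagrangian x'.a.disjoint_plus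
    (p := x.proj ∘ₗ e.symm.toLinearMap) (p' := x'.proj)
    (x.proj_surjective.comp e.symm.surjective) x'.proj_surjective
  refine ⟨σ * ρ, SpPlus_mul hσ hρ, moves_of_proj fun z => ?_⟩
  obtain ⟨z', h1, h2⟩ := h' (e z)
  refine ⟨z', h1, h2.trans ?_⟩
  simp

end Sp

end

/-! ### Existence of extended PPAVs over a PPAV -/

section Existence

variable {W : Type*} [NormedAddCommGroup W] [NormedSpace ℂ W] (P : PPAV W)
  {Z : Submodule ℂ H'} (hZ : perp Z = Z) (hd : Z ⊓ Hplus = ⊥) (p : Z →ₗ[ℂ] W)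

/-- The kernel in `H'` of a linear map defined on a subspace of `H'`. -/
def kerSub : Submodule ℂ H' := (LinearMap.ker p).map Z.subtype

theorem kerSub_le : kerSub p ≤ Z := Submodule.map_subtype_le _ _

theorem submoduleOf_kerSub : (kerSub p).submoduleOf Z = LinearMap.ker p :=
  Submodule.comap_map_eq_of_injective Z.injective_subtype _

/-- The isomorphism `Z / F ≅ W` for `F` the kernel of a surjection `Z → W`. -/
def tangentIso (hp : Function.Surjective p) : (Z ⧸ (kerSub p).submoduleOf Z) ≃ₗ[ℂ] W :=
  (Submodule.quotEquivOfEq _ _ (submoduleOf_kerSub p)).trans (p.quotKerEquivOfSurjective hp)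

theorem tangentIso_mk (hp : Function.Surjective p) (z : Z) :
    tangentIso p hp (((kerSub p).submoduleOf Z).mkQ z) = p z := rfl

/-- The antilinear map from `W` to `H'₊` defined by `⟨c(w), z⟩ = π B(w, p(z))`. -/
def conjPlus : W →ₗ⋆[ℂ] Hplus where
  toFun w := (dualEquiv hZ hd).symm ((Real.pi : ℂ) • (P.B w ∘ₗ p))
  map_add' u v := by rw [← map_add]; congr 1; ext z; simp
  map_smul' c u := by rw [← map_smul]; congr 1; ext z; simp; ring

theorem form_conjPlus (w : W) (z : Z) :
    form (conjPlus P hZ hd p w).1 z.1 = Real.pi * P.B w (p z) :=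
  form_dualEquiv_symm hZ hd _ z

theorem conjPlus_mem_perp (w : W) : (conjPlus P hZ hd p w).1 ∈ perp (kerSub p) := by
  rintro _ ⟨z, hz, rfl⟩
  change form z.1 _ = 0
  rw [form_skew, form_conjPlus, LinearMap.mem_ker.1 hz, map_zero, mul_zero, neg_zero]

theorem redForm_skew (F : Submodule ℂ H') (x y : Red F) : redForm F x y = -redForm F y x := by
  obtain ⟨f, rfl⟩ := Submodule.mkQ_surjective _ x
  obtain ⟨g, rfl⟩ := Submodule.mkQ_surjective _ y
  exact form_skew f.1 g.1

theorem redForm_redPlus {F : Submodule ℂ H'} {x y : Red F} (hx : x ∈ redPlus F)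
    (hy : y ∈ redPlus F) : redForm F x y = 0 := by
  obtain ⟨f, hf, rfl⟩ := hx
  obtain ⟨g, hg, rfl⟩ := hy
  exact form_Hplus hf hg

/-- The antilinear map from `W` to `F^⊥₊`. -/
def redConj : W →ₗ⋆[ℂ] Red (kerSub p) :=
  ((kerSub p).submoduleOf _).mkQ.comp
    ((Hplus.subtype.comp (conjPlus P hZ hd p)).codRestrict _ (conjPlus_mem_perp P hZ hd p))

theorem redConj_mem (w : W) : redConj P hZ hd p w ∈ redPlus (kerSub p) :=
  ⟨⟨_, conjPlus_mem_perp P hZ hd p w⟩, (conjPlus P hZ hd p w).2, rfl⟩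

variable (hp : Function.Surjective p)

/-- The linear map from `W` to `F^⊥ / F` with image `Z / F`. -/
def redLin : W →ₗ[ℂ] Red (kerSub p) :=
  redIncl (le_perp (kerSub_le p) hZ) ∘ₗ (tangentIso p hp).symm.toLinearMap

theorem redLin_tangentIso (u : Z ⧸ (kerSub p).submoduleOf Z) :
    redLin hZ p hp (tangentIso p hp u) = redIncl (le_perp (kerSub_le p) hZ) u := by
  rw [redLin, LinearMap.comp_apply, LinearEquiv.coe_coe, LinearEquiv.symm_apply_apply]

theorem redLin_proj (z : Z) : redLin hZ p hp (p z) =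
    ((kerSub p).submoduleOf _).mkQ ⟨z.1, le_perp (kerSub_le p) hZ z.2⟩ := by
  rw [← tangentIso_mk p hp, redLin_tangentIso]
  rfl

theorem redForm_redLin (u v : W) :
    redForm (kerSub p) (redLin hZ p hp u) (redLin hZ p hp v) = 0 := by
  obtain ⟨y, rfl⟩ := hp u
  obtain ⟨z, rfl⟩ := hp v
  rw [redLin_proj, redLin_proj, redForm_mkQ]
  exact form_lagrangian hZ y.2 z.2

theorem redForm_redConj_redLin (u v : W) :
    redForm (kerSub p) (redConj P hZ hd p u) (redLin hZ p hp v) = Real.pi * P.B u v := by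
  obtain ⟨z, rfl⟩ := hp v
  rw [redLin_proj]
  exact form_conjPlus P hZ hd p u z

theorem PPAV.eq_zero_of_B {w : W} (h : P.B w w = 0) : w = 0 := by
  by_contra hw
  have := P.positive w hw
  rw [h] at this
  simp at this

theorem pi_ne_zero' : (Real.pi : ℂ) ≠ 0 := by exact_mod_cast Real.pi_ne_zero

/-- `F^⊥₊` is isotropic and contains the conjugate of `w`, so pairing the two gives `π B(w, w) = 0`.
-/
theorem eq_zero_of_redLin_mem (P : PPAV W) (hZ : perp Z = Z) (hd : Z ⊓ Hplus = ⊥) (p : Z →ₗ[ℂ] W)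
    (hp : Function.Surjective p) {w : W} (h : redLin hZ p hp w ∈ redPlus (kerSub p)) : w = 0 := by
  have h1 := redForm_redPlus (redConj_mem P hZ hd p w) h
  rw [redForm_redConj_redLin] at h1
  exact P.eq_zero_of_B ((mul_eq_zero.1 h1).resolve_left pi_ne_zero')

/-- The embedding `w ↦ w + w̄` of `W` as the real part of `F^⊥ / F`. -/
def redReal : W →ₗ[ℝ] Red (kerSub p) where
  toFun w := redLin hZ p hp w + redConj P hZ hd p w
  map_add' u v := by simp only [map_add]; abel
  map_smul' r u := by
    have h : r • u = (r : ℂ) • u := rfl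
    rw [h, map_smul, LinearMap.map_smulₛₗ, Complex.conj_ofReal, ← smul_add]
    rfl

theorem redReal_apply (w : W) :
    redReal P hZ hd p hp w = redLin hZ p hp w + redConj P hZ hd p w := rfl

/-- `Z / F` and `F^⊥₊` are isotropic, so only the cross terms survive: `π (B(u, v) - B(v, u))`,
which is `2πi Im B(u, v)`. Integrality and unimodularity of the new lattice come from this. -/
theorem redForm_redReal (u v : W) :
    redForm (kerSub p) (redReal P hZ hd p hp u) (redReal P hZ hd p hp v) =
      2 * Real.pi * Complex.I * ((P.B u v).im : ℝ) := by
  have h1 := redForm_redLin hZ p hp u v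
  have h2 := redForm_redConj_redLin P hZ hd p hp u v
  have h3 := redForm_redConj_redLin P hZ hd p hp v u
  have h4 := redForm_redPlus (redConj_mem P hZ hd p u) (redConj_mem P hZ hd p v)
  have h5 := redForm_skew (kerSub p) (redLin hZ p hp u) (redConj P hZ hd p v)
  have h6 := Complex.sub_conj (P.B u v)
  rw [P.hermitian] at h6
  simp only [redReal_apply, map_add, LinearMap.add_apply]
  push_cast at h6
  linear_combination h1 + h2 - h3 + h4 + h5 + Real.pi * h6

theorem redReal_injective : Function.Injective (redReal P hZ hd p hp) := by
  rw [← LinearMap.ker_eq_bot, LinearMap.ker_eq_bot']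
  intro w hw
  refine eq_zero_of_redLin_mem P hZ hd p hp ?_
  rw [redReal_apply] at hw
  rw [eq_neg_of_add_eq_zero_left hw]
  exact Submodule.neg_mem _ (redConj_mem P hZ hd p w)

/-- The lattice in `F^⊥ / F`. -/
def redLattice : Submodule ℤ (Red (kerSub p)) :=
  P.Λ.map (redReal P hZ hd p hp).toAddMonoidHom.toIntLinearMap

/-- The identification of the lattices in `W` and in `F^⊥ / F`. -/
def latticeEquiv : P.Λ ≃ₗ[ℤ] redLattice P hZ hd p hp :=
  Submodule.equivMapOfInjective (redReal P hZ hd p hp).toAddMonoidHom.toIntLinearMap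
    (redReal_injective P hZ hd p hp) P.Λ

theorem latticeEquiv_coe (u : P.Λ) :
    (latticeEquiv P hZ hd p hp u).1 = redReal P hZ hd p hp u.1 := rfl

theorem mem_span_redLattice (x : Red (kerSub p)) :
    x ∈ Submodule.span ℝ (redLattice P hZ hd p hp : Set (Red (kerSub p))) ↔
      ∃ w, redReal P hZ hd p hp w = x := by
  have : (redLattice P hZ hd p hp : Set (Red (kerSub p))) =
    redReal P hZ hd p hp '' (P.Λ : Set W) := rfl
  rw [this, Submodule.span_image, P.span_top, Submodule.map_top]
  exact LinearMap.mem_range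

theorem isConj_redLin (u : W) :
    IsConj (redLattice P hZ hd p hp) (redLin hZ p hp u) (redConj P hZ hd p u) := by
  have hI : Complex.I * Complex.I = -1 := Complex.I_mul_I
  -- With `ū` for `redConj u`, the real and imaginary parts of `u` are `(u + ū) / 2` and `(u - ū) /
  -- (2i)`, the images under `redReal` of `u / 2` and `-i u / 2`.
  refine ⟨_, (mem_span_redLattice P hZ hd p hp _).2 ⟨(2⁻¹ : ℂ) • u, rfl⟩,
    _, (mem_span_redLattice P hZ hd p hp _).2 ⟨(-(2⁻¹ * Complex.I) : ℂ) • u, rfl⟩, ?_, ?_⟩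
  · simp only [redReal_apply, map_smul, LinearMap.map_smulₛₗ, map_neg, map_mul, map_inv₀,
      Complex.conj_I, map_ofNat]
    match_scalars <;>
      first | linear_combination (1 / 2 : ℂ) * hI | linear_combination (-1 / 2 : ℂ) * hI
  · simp only [redReal_apply, map_smul, LinearMap.map_smulₛₗ, map_neg, map_mul, map_inv₀,
      Complex.conj_I, map_ofNat]
    match_scalars <;>
      first | linear_combination (1 / 2 : ℂ) * hI | linear_combination (-1 / 2 : ℂ) * hI

/-- Comparing components in `Z / F` and `F^⊥₊` determines the real and imaginary parts: for `x = a +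
ā` and `y = b + b̄`, positivity of `B` forces `u = a + i b` and `a = i b`. -/
theorem eq_redConj_of_isConj {u : W} {u' : Red (kerSub p)}
    (h : IsConj (redLattice P hZ hd p hp) (redLin hZ p hp u) u') : u' = redConj P hZ hd p u := by
  obtain ⟨x, hx, y, hy, h1, rfl⟩ := h
  obtain ⟨a, rfl⟩ := (mem_span_redLattice P hZ hd p hp x).1 hx
  obtain ⟨b, rfl⟩ := (mem_span_redLattice P hZ hd p hp y).1 hy
  have h2 : redLin hZ p hp (u - a - Complex.I • b) = redConj P hZ hd p (a - Complex.I • b) := by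
    simp only [redReal_apply] at h1
    simp only [map_sub, h1, map_smul, LinearMap.map_smulₛₗ, Complex.conj_I]
    module
  have h3 : u - a - Complex.I • b = 0 :=
    eq_zero_of_redLin_mem P hZ hd p hp (h2 ▸ redConj_mem P hZ hd p _)
  have h4 : a - Complex.I • b = 0 := by
    rw [h3, map_zero] at h2
    have := redForm_redConj_redLin P hZ hd p hp (a - Complex.I • b) (a - Complex.I • b)
    rw [← h2, map_zero, LinearMap.zero_apply] at this
    exact P.eq_zero_of_B ((mul_eq_zero.1 this.symm).resolve_left pi_ne_zero')
  have h5 : u = a + Complex.I • b := by rw [← sub_eq_zero, ← h3]; abel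
  have h6 : redLin hZ p hp a = Complex.I • redLin hZ p hp b := by
    rw [← map_smul, sub_eq_zero.1 h4]
  rw [h5, redReal_apply, redReal_apply, h6]
  simp only [map_add, LinearMap.map_smulₛₗ, Complex.conj_I]
  module

theorem PPAV.isZLattice [DiscreteTopology P.Λ] : IsZLattice ℝ P.Λ := ⟨P.span_top⟩

variable [FiniteDimensional ℂ W]

theorem PPAV.finite_lattice : Module.Finite ℤ P.Λ := by
  have := P.discrete
  have := P.isZLattice
  have : FiniteDimensional ℝ W := FiniteDimensional.complexToReal W
  exact ZLattice.module_finite ℝ P.Λ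

theorem PPAV.finrank_lattice : Module.finrank ℤ P.Λ = 2 * Module.finrank ℂ W := by
  have := P.discrete
  have := P.isZLattice
  have : FiniteDimensional ℝ W := FiniteDimensional.complexToReal W
  rw [ZLattice.rank ℝ P.Λ, finrank_real_of_complex]

/-- The extended PPAV attached to a surjection from a Lagrangian complement of `H'₊` onto the
tangent space of a PPAV. -/
def extOfSurjection : ExtPPAV (Module.finrank ℂ W) where
  Z := Z
  F := kerSub p
  F_le := kerSub_le p
  lagrangian := hZ
  finite := Module.Finite.equiv (tangentIso p hp).symm
  codim := (tangentIso p hp).finrank_eq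
  L := redLattice P hZ hd p hp
  L_fg := by
    have := P.finite_lattice
    exact Submodule.FG.map _ (Module.Finite.iff_fg.1 this)
  L_rank := (latticeEquiv P hZ hd p hp).finrank_eq.symm.trans P.finrank_lattice
  disjoint_plus := hd
  disjoint_real x hx hx' := by
    obtain ⟨w, rfl⟩ := (mem_span_redLattice P hZ hd p hp x).1 hx
    rw [redReal_apply] at hx'
    rw [eq_zero_of_redLin_mem P hZ hd p hp
      ((Submodule.add_mem_iff_left _ (redConj_mem P hZ hd p w)).1 hx'), map_zero]
  conj_plus u := by
    refine ⟨_, redConj_mem P hZ hd p (tangentIso p hp u), ?_⟩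
    rw [← redLin_tangentIso hZ p hp]
    exact isConj_redLin P hZ hd p hp _
  integral := by
    rintro _ ⟨u, hu, rfl⟩ _ ⟨v, hv, rfl⟩
    obtain ⟨n, hn⟩ := P.integral u hu v hv
    refine ⟨n, (redForm_redReal P hZ hd p hp u v).trans ?_⟩
    rw [hn]
    simp
  unimodular φ := by
    have hc : (2 * Real.pi * Complex.I : ℂ) ≠ 0 := by simp [Real.pi_ne_zero]
    have key (u : P.Λ) : (∀ m : redLattice P hZ hd p hp,
        redForm (kerSub p) (latticeEquiv P hZ hd p hp u).1 m.1 =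
          2 * Real.pi * Complex.I * (φ m : ℤ)) ↔
        ∀ v : P.Λ, (P.B u.1 v.1).im =
          ((φ ∘ₗ (latticeEquiv P hZ hd p hp).toLinearMap) v : ℤ) := by
      rw [(latticeEquiv P hZ hd p hp).surjective.forall]
      refine forall_congr' fun v => ?_
      rw [latticeEquiv_coe, latticeEquiv_coe, redForm_redReal, mul_right_inj' hc]
      exact ⟨fun h => by exact_mod_cast h, fun h => by rw [h]; simp⟩
    obtain ⟨u, hu, huniq⟩ := P.unimodular (φ ∘ₗ (latticeEquiv P hZ hd p hp).toLinearMap)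
    refine ⟨latticeEquiv P hZ hd p hp u, (key u).2 hu, fun l hl => ?_⟩
    obtain ⟨v, rfl⟩ := (latticeEquiv P hZ hd p hp).surjective l
    rw [huniq v ((key v).1 hl)]
  positive u hu u' h := by
    rw [← redLin_tangentIso hZ p hp] at h ⊢
    rw [eq_redConj_of_isConj P hZ hd p hp h, redForm_redConj_redLin, ← mul_assoc,
      one_div_mul_cancel pi_ne_zero', one_mul]
    exact P.positive _ ((LinearEquiv.map_ne_zero_iff _).2 hu)

/-- The point of `Sp(X, Θ)` attached to a surjection from a Lagrangian complement of `H'₊` onto the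
tangent space of a PPAV. -/
def spOfSurjection : Sp P where
  a := extOfSurjection P hZ hd p hp
  iso := tangentIso p hp
  iso_lattice u := by
    have hincl : (extOfSurjection P hZ hd p hp).incl u = redLin hZ p hp (tangentIso p hp u) :=
      (redLin_tangentIso hZ p hp u).symm
    constructor
    · intro hu
      refine ⟨_, redConj_mem P hZ hd p (tangentIso p hp u), ?_⟩
      rw [hincl]
      exact ⟨_, hu, rfl⟩
    · rintro ⟨(k : Red (kerSub p)), (hk : k ∈ redPlus (kerSub p)), w, hw, h⟩
      change redReal P hZ hd p hp w = _ at h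
      rw [hincl, redReal_apply] at h
      -- Modulo `F^⊥₊` the lattice vector `w + w̄` has component `w`, so it can lie over `u` only if
      -- `w` is the image of `u`.
      have h1 : redLin hZ p hp (w - tangentIso p hp u) = k - redConj P hZ hd p w := by
        rw [map_sub, sub_eq_sub_iff_add_eq_add]
        exact h.trans (add_comm _ _)
      have h2 := eq_zero_of_redLin_mem P hZ hd p hp (w := w - tangentIso p hp u)
        (h1 ▸ Submodule.sub_mem _ hk (redConj_mem P hZ hd p w))
      exact (congrArg (· ∈ P.Λ) (sub_eq_zero.1 h2)).mp hw
  iso_form u v u' h := by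
    have hincl (u) : (extOfSurjection P hZ hd p hp).incl u = redLin hZ p hp (tangentIso p hp u) :=
      (redLin_tangentIso hZ p hp u).symm
    rw [hincl] at h ⊢
    rw [eq_redConj_of_isConj P hZ hd p hp h]
    change _ = _ * redForm (kerSub p) _ _
    rw [redForm_redConj_redLin, ← mul_assoc, one_div_mul_cancel pi_ne_zero', one_mul]
    rfl

end Existence

/-- `W` embeds in the infinite-dimensional `t⁻¹ ℂ[t⁻¹]`, and a left inverse of the embedding is the
required surjection. Over an empty base the space of families would be zero. -/
theorem nonempty_Sp {W : Type*} [NormedAddCommGroup W] [NormedSpace ℂ W] [FiniteDimensional ℂ W]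
    (P : PPAV W) : Nonempty (Sp P) := by
  obtain ⟨j, hj⟩ := exists_injective_of_not_finite (W := W) (V := Hminus)
    (not_finite_lagrangian perp_Hminus Hminus_inf_Hplus)
  obtain ⟨p, hp⟩ := j.exists_leftInverse_of_injective (LinearMap.ker_eq_bot.2 hj)
  exact ⟨spOfSurjection P perp_Hminus Hminus_inf_Hplus p fun w => ⟨j w, LinearMap.congr_fun hp w⟩⟩

/-! ### Coinvariants of the Fock space of level zero -/

section Fock

attribute [local instance] LieRing.ofAssociativeRing

variable {Γ : Type*} [AddCommGroup Γ] (q : EvenLattice Γ)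

theorem env_induction {C : Env q → Prop} (halg : ∀ c, C (algebraMap ℂ (Env q) c))
    (hι : ∀ x, C (UniversalEnvelopingAlgebra.ι ℂ x)) (hmul : ∀ u v, C u → C v → C (u * v))
    (hadd : ∀ u v, C u → C v → C (u + v)) (u : Env q) : C u := by
  obtain ⟨a, rfl⟩ : ∃ a, UniversalEnvelopingAlgebra.mkAlgHom ℂ (Heis q) a = u :=
    Quotient.mk_surjective u
  induction a using TensorAlgebra.induction with
  | algebraMap c => rw [AlgHom.commutes]; exact halg c
  | ι x => exact hι x
  | mul x y hx hy => rw [map_mul]; exact hmul _ _ hx hy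
  | add x y hx hy => rw [map_add]; exact hadd _ _ hx hy

theorem ι_mul_sub (x y : Heis q) :
    UniversalEnvelopingAlgebra.ι ℂ x * UniversalEnvelopingAlgebra.ι ℂ y -
      UniversalEnvelopingAlgebra.ι ℂ y * UniversalEnvelopingAlgebra.ι ℂ x =
    loopForm q x.1 y.1 • UniversalEnvelopingAlgebra.ι ℂ (Heis.central q) := by
  rw [← LieRing.of_associative_ring_bracket, ← LieHom.map_lie, ← map_smul]
  congr 1
  refine Prod.ext (smul_zero _).symm ?_
  exact (mul_one _).symm

theorem central_commute (u : Env q) :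
    Commute (UniversalEnvelopingAlgebra.ι ℂ (Heis.central q)) u := by
  induction u using env_induction with
  | halg c => exact (Algebra.commutes c _).symm
  | hι x =>
    rw [commute_iff_eq, ← sub_eq_zero, ι_mul_sub]
    have : loopForm q (Heis.central q).1 x.1 = 0 := by
      change loopForm q 0 x.1 = 0
      simp
    rw [this, zero_smul]
  | hmul u v hu hv => exact hu.mul_right hv
  | hadd u v hu hv => exact hu.add_right hv

/-- `𝟏` commutes with the enveloping algebra and kills the vacuum at level zero, and the vacuum
generates. -/
theorem central_smul (w : Fock q 0) : UniversalEnvelopingAlgebra.ι ℂ (Heis.central q) • w = 0 := by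
  obtain ⟨u, rfl⟩ := (vacIdeal q 0).mkQ_surjective w
  rw [← map_smul, smul_eq_mul, (central_commute q u).eq, ← smul_eq_mul, map_smul]
  have : (vacIdeal q 0).mkQ (UniversalEnvelopingAlgebra.ι ℂ (Heis.central q)) = 0 := by
    rw [Submodule.mkQ_apply, Submodule.Quotient.mk_eq_zero]
    have h : UniversalEnvelopingAlgebra.ι ℂ (Heis.central q) - algebraMap ℂ (Env q) 0 ∈
      vacIdeal q 0 := Submodule.subset_span (Or.inr rfl)
    rwa [map_zero, sub_zero] at h
  rw [this, smul_zero]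

theorem loop_smul_vac (A : Cartan Γ) {f : H} (hf : f ∈ tPow 0) :
    UniversalEnvelopingAlgebra.ι ℂ (Heis.loop q (A ⊗ₜ f)) • vac q 0 = 0 := by
  rw [vac, ← map_smul, smul_eq_mul, mul_one, Submodule.mkQ_apply, Submodule.Quotient.mk_eq_zero]
  exact Submodule.subset_span (Or.inl ⟨A, f, hf, rfl⟩)

/-- The action of the enveloping algebra on the Fock space. -/
def act : Env q →ₐ[ℂ] Module.End ℂ (Fock q 0) := Algebra.lsmul ℂ ℂ (Fock q 0)

/-- Commutators of Heisenberg elements are multiples of `𝟏`, which acts by zero. This makes the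
operators a commutative algebra, so that ideals and symmetric algebras apply. -/
theorem act_commute (u v : Env q) : Commute (act q u) (act q v) := by
  induction u using env_induction with
  | halg c => rw [AlgHom.commutes]; exact Algebra.commutes c _
  | hmul u u' hu hu' => rw [map_mul]; exact hu.mul_left hu'
  | hadd u u' hu hu' => rw [map_add]; exact hu.add_left hu'
  | hι x =>
    induction v using env_induction with
    | halg c => rw [AlgHom.commutes]; exact (Algebra.commutes c _).symm
    | hmul u u' hu hu' => rw [map_mul]; exact hu.mul_right hu'
    | hadd u u' hu hu' => rw [map_add]; exact hu.add_right hu'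
    | hι y =>
      rw [commute_iff_eq, ← sub_eq_zero, ← map_mul (act q), ← map_mul (act q), ← map_sub,
        ι_mul_sub, map_smul]
      refine (congrArg _ (LinearMap.ext fun w => ?_)).trans (smul_zero _)
      exact central_smul q w

theorem smul_smul_comm (u v : Env q) (w : Fock q 0) : u • v • w = v • u • w :=
  LinearMap.congr_fun (act_commute q u v).eq w

/-- The commutative algebra of operators on the Fock space of level zero. -/
abbrev Ops : Type _ := (act q).range

instance : CommRing (Ops q) where
  mul_comm := by
    rintro ⟨_, u, rfl⟩ ⟨_, v, rfl⟩
    exact Subtype.ext (act_commute q u v).eq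

theorem Fock.exists_smul_vac (w : Fock q 0) : ∃ u : Env q, w = u • vac q 0 := by
  obtain ⟨u, rfl⟩ := (vacIdeal q 0).mkQ_surjective w
  exact ⟨u, by rw [vac, ← map_smul, smul_eq_mul, mul_one]⟩

/-! ### Symbols and the computation of the coinvariants -/

variable {F : Submodule ℂ H'} {M : Type*} [AddCommGroup M] [Module ℂ M]

/-- The homomorphism from the enveloping algebra to `Sym(𝔥_Γ ⊗ M)` induced by a linear map
`H' → M`. -/
def symbol (π : H' →ₗ[ℂ] M) : Env q →ₐ[ℂ] SymmetricAlgebra ℂ (Cartan Γ ⊗[ℂ] M) :=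
  UniversalEnvelopingAlgebra.lift ℂ
    { toLinearMap := SymmetricAlgebra.ι ℂ _ ∘ₗ (π ∘ₗ constLine.mkQ).lTensor (Cartan Γ) ∘ₗ
        (LinearMap.fst ℂ (Cartan Γ ⊗[ℂ] H) ℂ : Heis q →ₗ[ℂ] Cartan Γ ⊗[ℂ] H)
      map_lie' := by
        intro x y
        rw [LieRing.of_associative_ring_bracket, mul_comm, sub_self]
        change SymmetricAlgebra.ι ℂ _ ((π ∘ₗ constLine.mkQ).lTensor (Cartan Γ) 0) = 0
        simp }

theorem symbol_ι (π : H' →ₗ[ℂ] M) (x : Heis q) :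
    symbol q π (UniversalEnvelopingAlgebra.ι ℂ x) =
      SymmetricAlgebra.ι ℂ _ ((π ∘ₗ constLine.mkQ).lTensor (Cartan Γ) x.1) := by
  rw [symbol, UniversalEnvelopingAlgebra.lift_ι_apply]
  rfl

theorem symbol_loop (π : H' →ₗ[ℂ] M) (A : Cartan Γ) (f : H) :
    symbol q π (UniversalEnvelopingAlgebra.ι ℂ (Heis.loop q (A ⊗ₜ f))) =
      SymmetricAlgebra.ι ℂ _ (A ⊗ₜ π (constLine.mkQ f)) := symbol_ι q π _

theorem symbol_mode (π : H' →ₗ[ℂ] M) (A : Cartan Γ) (f : H') :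
    symbol q π (mode q A f) = SymmetricAlgebra.ι ℂ _ (A ⊗ₜ π f) := by
  rw [mode, symbol_loop, mk_sec]

theorem mk_mem_Hplus {f : H} (hf : f ∈ tPow 0) : constLine.mkQ f ∈ Hplus := by
  refine ⟨_, sub_mem_tPow (mem_tPow.1 hf), ?_⟩
  rw [← sec_mk, mk_sec]

theorem mem_tPow_zero_of_mk {f : H} (hf : constLine.mkQ f ∈ Hplus) : f ∈ tPow 0 := by
  have h := sec_mem_tPow hf
  rw [sec_mk, mem_tPow] at h
  refine mem_tPow.2 fun m hm => ?_
  have h1 := h m (by omega)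
  rwa [map_sub, map_smul, coeff_bZero, if_neg hm.ne, smul_zero, sub_zero] at h1

theorem symbol_vacIdeal {π : H' →ₗ[ℂ] M} (hπ : ∀ x ∈ Hplus, π x = 0) {u : Env q}
    (hu : u ∈ vacIdeal q 0) : symbol q π u = 0 := by
  induction hu using Submodule.span_induction with
  | zero => exact map_zero _
  | add x y _ _ hx hy => rw [map_add, hx, hy, add_zero]
  | smul c x _ hx => rw [smul_eq_mul, map_mul, hx, mul_zero]
  | mem x hx =>
    rcases hx with ⟨A, f, hf, rfl⟩ | hx
    · rw [symbol_loop, hπ _ (mk_mem_Hplus hf)]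
      simp
    · rw [Set.mem_singleton_iff.1 hx, map_zero, sub_zero, symbol_ι]
      change SymmetricAlgebra.ι ℂ _ ((π ∘ₗ constLine.mkQ).lTensor (Cartan Γ) 0) = 0
      simp

/-- The map from the Fock space to `Sym(𝔥_Γ ⊗ M)` induced by a linear map `H' → M` that vanishes on
`H'₊`. -/
def fockSymbol (π : H' →ₗ[ℂ] M) (hπ : ∀ x ∈ Hplus, π x = 0) :
    Fock q 0 →ₗ[ℂ] SymmetricAlgebra ℂ (Cartan Γ ⊗[ℂ] M) :=
  ((vacIdeal q 0).restrictScalars ℂ).liftQ (symbol q π).toLinearMap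
    fun _ hu => symbol_vacIdeal q hπ hu

theorem fockSymbol_smul_vac (π : H' →ₗ[ℂ] M) (hπ : ∀ x ∈ Hplus, π x = 0) (u : Env q) :
    fockSymbol q π hπ (u • vac q 0) = symbol q π u := by
  have : u • vac q 0 = (vacIdeal q 0).mkQ u := by
    rw [vac, ← map_smul, smul_eq_mul, mul_one]
  rw [this]
  rfl

theorem symbol_surjective {π : H' →ₗ[ℂ] M} (hs : Function.Surjective π) :
    Function.Surjective (symbol q π) := by
  intro s
  induction s using SymmetricAlgebra.induction with
  | algebraMap c => exact ⟨algebraMap ℂ _ c, AlgHom.commutes _ c⟩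
  | mul a b ha hb =>
    obtain ⟨u, rfl⟩ := ha
    obtain ⟨v, rfl⟩ := hb
    exact ⟨u * v, map_mul _ u v⟩
  | add a b ha hb =>
    obtain ⟨u, rfl⟩ := ha
    obtain ⟨v, rfl⟩ := hb
    exact ⟨u + v, map_add _ u v⟩
  | ι x =>
    induction x with
    | zero => exact ⟨0, by simp⟩
    | add x y hx hy =>
      obtain ⟨u, hu⟩ := hx
      obtain ⟨v, hv⟩ := hy
      exact ⟨u + v, by rw [map_add, map_add, hu, hv]⟩
    | tmul A m =>
      obtain ⟨f, rfl⟩ := hs m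
      exact ⟨mode q A f, symbol_mode q π A f⟩

/-- This is the injectivity half of `coinvEquiv`. Modulo the ideal `I` generated by the `A ⊗ f` with
`π f = 0`, an operator depends only on its symbol, so symbol zero puts the operator in `I`; and `I`
maps the Fock space into `outSub`. -/
theorem smul_vac_mem_outSub {π : H' →ₗ[ℂ] M} (hs : Function.Surjective π)
    (hker : LinearMap.ker π = F ⊔ Hplus) {u : Env q} (hu : symbol q π u = 0) :
    u • vac q 0 ∈ outSub q 0 F := by
  obtain ⟨s, hs⟩ := π.exists_rightInverse_of_surjective (LinearMap.range_eq_top.2 hs)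
  let T : Env q →ₐ[ℂ] Ops q := (act q).rangeRestrict
  let τ : Cartan Γ ⊗[ℂ] H →ₗ[ℂ] Ops q :=
    T.toLinearMap ∘ₗ (UniversalEnvelopingAlgebra.ι ℂ : Heis q →ₗ⁅ℂ⁆ Env q).toLinearMap ∘ₗ
      Heis.loop q
  let I : Ideal (Ops q) := Ideal.span {o | ∃ (A : Cartan Γ) (f : H),
    π (constLine.mkQ f) = 0 ∧ o = τ (A ⊗ₜ f)}
  let Q : Ops q →ₐ[ℂ] Ops q ⧸ I := Ideal.Quotient.mkₐ ℂ I
  let ψ : SymmetricAlgebra ℂ (Cartan Γ ⊗[ℂ] M) →ₐ[ℂ] Ops q :=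
    SymmetricAlgebra.lift (τ ∘ₗ (sec ∘ₗ s).lTensor (Cartan Γ))
  have hcentral : T (UniversalEnvelopingAlgebra.ι ℂ (Heis.central q)) = 0 :=
    Subtype.ext (LinearMap.ext fun w => central_smul q w)
  have hτ (x : Heis q) : T (UniversalEnvelopingAlgebra.ι ℂ x) = τ x.1 := by
    have hx : x = Heis.loop q x.1 + x.2 • Heis.central q := by
      refine Prod.ext ?_ ?_
      · change x.1 = x.1 + x.2 • 0
        simp
      · change x.2 = 0 + x.2 • 1
        simp
    conv_lhs => rw [hx]
    rw [map_add, map_smul, map_add, map_smul, hcentral, smul_zero, add_zero]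
    rfl
  have hτI (x : Cartan Γ ⊗[ℂ] H) :
      Q (ψ (SymmetricAlgebra.ι ℂ _ ((π ∘ₗ constLine.mkQ).lTensor (Cartan Γ) x))) = Q (τ x) := by
    induction x with
    | zero => simp
    | add x y hx hy => simp only [map_add, hx, hy]
    | tmul A f =>
      rw [← sub_eq_zero, ← map_sub]
      refine Ideal.Quotient.eq_zero_iff_mem.2 (Ideal.subset_span
        ⟨A, sec (s (π (constLine.mkQ f))) - f, ?_, ?_⟩)
      · rw [map_sub, mk_sec, map_sub, sub_eq_zero]
        exact LinearMap.congr_fun hs _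
      · rw [TensorProduct.tmul_sub, map_sub]
        congr 1
        simp only [ψ, SymmetricAlgebra.lift_ι_apply]
        rfl
  -- A section `s` of `π` gives a homomorphism `ψ` from symbols back to operators. It inverts
  -- `symbol` only modulo `I`, since `s (π f)` and `f` differ by an element of the kernel.
  have hcomp : (Q.comp ψ).comp (symbol q π) = Q.comp T := by
    refine UniversalEnvelopingAlgebra.hom_ext ℂ (LieHom.ext fun x => ?_)
    change Q (ψ (symbol q π (UniversalEnvelopingAlgebra.ι ℂ x))) =
      Q (T (UniversalEnvelopingAlgebra.ι ℂ x))
    rw [symbol_ι, hτI, hτ]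
  have hTu : T u ∈ I := by
    have h := AlgHom.congr_fun hcomp u
    change Q (ψ (symbol q π u)) = Q (T u) at h
    rw [hu, map_zero, map_zero] at h
    exact Ideal.Quotient.eq_zero_iff_mem.1 h.symm
  have hI : ∀ o ∈ I, ∀ w, o.1 w ∈ outSub q 0 F := by
    intro o ho
    induction ho using Submodule.span_induction with
    | zero => exact fun w => Submodule.zero_mem _
    | add x y _ _ hx hy => exact fun w => Submodule.add_mem _ (hx w) (hy w)
    | smul c x _ hx =>
      intro w
      -- Commutativity places the generator on the outside, where its image is controlled.
      rw [smul_eq_mul, mul_comm]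
      exact hx (c.1 w)
    | mem x hx =>
      obtain ⟨A, f, hf, rfl⟩ := hx
      intro w
      rw [← LinearMap.mem_ker, hker] at hf
      obtain ⟨a, ha, b, hb, hab⟩ := Submodule.mem_sup.1 hf
      -- The `F` part of `f` lands in `outSub` by definition; the rest commutes past `v` and kills
      -- the vacuum. It lies in `ℂ[[t]]` rather than `t ℂ[[t]]`, because `f` may have a constant
      -- term.
      have hsub : f - sec a ∈ tPow 0 := mem_tPow_zero_of_mk (by
        rwa [map_sub, mk_sec, ← hab, add_sub_cancel_left])
      obtain ⟨v, rfl⟩ := Fock.exists_smul_vac q w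
      have h1 : (τ (A ⊗ₜ f)).1 (v • vac q 0) = mode q A a • v • vac q 0 +
          UniversalEnvelopingAlgebra.ι ℂ (Heis.loop q (A ⊗ₜ (f - sec a))) • v • vac q 0 := by
        rw [mode, ← add_smul, ← map_add, ← map_add, ← TensorProduct.tmul_add, add_sub_cancel]
        rfl
      rw [h1, smul_smul_comm q (UniversalEnvelopingAlgebra.ι ℂ _) v, loop_smul_vac q A hsub,
        smul_zero, add_zero]
      exact Submodule.subset_span ⟨A, a, _, ha, rfl⟩
  exact hI _ hTu _

theorem fockSymbol_smul (π : H' →ₗ[ℂ] M) (hπ : ∀ x ∈ Hplus, π x = 0) (u : Env q) (w : Fock q 0) :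
    fockSymbol q π hπ (u • w) = symbol q π u * fockSymbol q π hπ w := by
  obtain ⟨v, rfl⟩ := Fock.exists_smul_vac q w
  rw [← mul_smul, fockSymbol_smul_vac, fockSymbol_smul_vac, map_mul]

/-- The coinvariants for the subspace `F` are `Sym(𝔥_Γ ⊗ M)`, for `H' → M` a surjection with
kernel `F + H'₊`. -/
def coinvEquiv (π : H' →ₗ[ℂ] M) (hs : Function.Surjective π)
    (hker : LinearMap.ker π = F ⊔ Hplus) :
    ExtCoinv q 0 F ≃ₗ[ℂ] SymmetricAlgebra ℂ (Cartan Γ ⊗[ℂ] M) :=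
  have hπ : ∀ x ∈ Hplus, π x = 0 := fun _ hx => hker.ge (Submodule.mem_sup_right hx)
  have hF : ∀ x ∈ F, π x = 0 := fun _ hx => hker.ge (Submodule.mem_sup_left hx)
  LinearEquiv.ofBijective
    ((outSub q 0 F).liftQ (fockSymbol q π hπ) (by
      refine Submodule.span_le.2 ?_
      rintro _ ⟨A, f, w, hf, rfl⟩
      change fockSymbol q π hπ _ = 0
      rw [fockSymbol_smul, symbol_mode, hF f hf]
      simp)) (by
    constructor
    · rw [← LinearMap.ker_eq_bot, LinearMap.ker_eq_bot']
      intro c hc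
      obtain ⟨w, rfl⟩ := (outSub q 0 F).mkQ_surjective c
      obtain ⟨u, rfl⟩ := Fock.exists_smul_vac q w
      rw [Submodule.mkQ_apply, Submodule.Quotient.mk_eq_zero]
      refine smul_vac_mem_outSub q hs hker ?_
      rw [← fockSymbol_smul_vac q π hπ]
      exact hc
    · intro s
      obtain ⟨u, rfl⟩ := symbol_surjective q hs s
      exact ⟨(outSub q 0 F).mkQ (u • vac q 0), fockSymbol_smul_vac q π hπ u⟩)

theorem coinvEquiv_smul_vac (π : H' →ₗ[ℂ] M) (hs : Function.Surjective π)
    (hker : LinearMap.ker π = F ⊔ Hplus) (u : Env q) :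
    coinvEquiv q π hs hker ((outSub q 0 F).mkQ (u • vac q 0)) = symbol q π u :=
  fockSymbol_smul_vac q π (fun _ hx => hker.ge (Submodule.mem_sup_right hx)) u

theorem coinvEquiv_monomial (π : H' →ₗ[ℂ] M) (hs : Function.Surjective π)
    (hker : LinearMap.ker π = F ⊔ Hplus) (l : List (Cartan Γ × H')) :
    coinvEquiv q π hs hker ((outSub q 0 F).mkQ (monomial q 0 l)) =
      (l.map fun p => SymmetricAlgebra.ι ℂ _ (p.1 ⊗ₜ[ℂ] π p.2)).prod := by
  rw [monomial, coinvEquiv_smul_vac, map_list_prod, List.map_map]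
  congr 2
  funext p
  exact symbol_mode q π p.1 p.2

theorem symbol_envHom {π π' : H' →ₗ[ℂ] M} {ρ : SpFull} (h : ∀ f, π' (ρ.1 f) = π f) (u : Env q) :
    symbol q π' (envHom q ρ u) = symbol q π u := by
  refine AlgHom.congr_fun (φ₁ := (symbol q π').comp (envHom q ρ)) (φ₂ := symbol q π) ?_ u
  refine UniversalEnvelopingAlgebra.hom_ext ℂ (LieHom.ext fun x => ?_)
  change symbol q π' (envHom q ρ (UniversalEnvelopingAlgebra.ι ℂ x)) =
    symbol q π (UniversalEnvelopingAlgebra.ι ℂ x)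
  rw [envHom_ι, symbol_ι, symbol_ι]
  congr 1
  change ((π' ∘ₗ constLine.mkQ).lTensor (Cartan Γ)) ((liftH ρ).lTensor (Cartan Γ) x.1) = _
  rw [← LinearMap.comp_apply, ← LinearMap.lTensor_comp]
  congr 2
  ext f
  change π' (constLine.mkQ (liftH ρ f)) = π (constLine.mkQ f)
  rw [mk_liftH, h]

/-- Since `ρ` carries `π` to `π'`, it preserves symbols. In these identifications the action on
coinvariants becomes the identity. -/
theorem coinvEquiv_coinvMap {F' : Submodule ℂ H'} {π π' : H' →ₗ[ℂ] M}
    (hs : Function.Surjective π) (hker : LinearMap.ker π = F ⊔ Hplus)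
    (hs' : Function.Surjective π') (hker' : LinearMap.ker π' = F' ⊔ Hplus) {ρ : SpFull}
    (hρ : ∀ f, π' (ρ.1 f) = π f) (hF : ∀ f, ρ.1 f ∈ F' ↔ f ∈ F) (c : ExtCoinv q 0 F) :
    coinvEquiv q π' hs' hker' (coinvMap q ρ 0 hF c) = coinvEquiv q π hs hker c := by
  obtain ⟨w, rfl⟩ := (outSub q 0 F).mkQ_surjective c
  obtain ⟨u, rfl⟩ := Fock.exists_smul_vac q w
  have h : coinvMap q ρ 0 hF ((outSub q 0 F).mkQ (u • vac q 0)) =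
      (outSub q 0 F').mkQ (envHom q ρ u • vac q 0) := by
    change (outSub q 0 F').mkQ (fockMap q ρ 0 (u • vac q 0)) = _
    rw [fockMap_smul, fockMap_vac]
  rw [h, coinvEquiv_smul_vac, coinvEquiv_smul_vac, symbol_envHom q hρ]

end Fock

/-! ### One-forms on a complex torus -/

section OneForms

variable {W : Type*} [NormedAddCommGroup W] [NormedSpace ℂ W] [FiniteDimensional ℂ W] (P : PPAV W)

/-- Holomorphic one-forms on a complex torus are translation invariant. -/
theorem PPAV.oneForm_eq (η : P.OneForms) (y : P.X) : η.1 y = η.1 0 := by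
  have := P.discrete
  have := P.isZLattice
  have : FiniteDimensional ℝ W := FiniteDimensional.complexToReal W
  have hη : Differentiable ℂ fun w : W => η.1 (P.Λ.mkQ w) := η.2
  -- The pull-back to `W` is periodic for a full lattice, so its range is compact; a bounded
  -- holomorphic function on `W` is constant by Liouville.
  have hc := IsZLattice.isCompact_range_of_periodic P.Λ (fun w : W => η.1 (P.Λ.mkQ w))
    hη.continuous fun z w hw => by
      have : P.Λ.mkQ w = 0 := (Submodule.Quotient.mk_eq_zero _).2 hw
      change η.1 (P.Λ.mkQ (z + w)) = η.1 (P.Λ.mkQ z)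
      rw [map_add, this, add_zero]
  obtain ⟨w, rfl⟩ := P.Λ.mkQ_surjective y
  have := hη.apply_eq_apply_of_bounded hc.isBounded w 0
  simpa using this

/-- One-forms on a complex torus are identified with linear forms on its tangent space. -/
def PPAV.oneFormsEquiv : P.OneForms ≃ₗ[ℂ] Module.Dual ℂ W where
  toFun η := (η.1 0).toLinearMap
  map_add' _ _ := rfl
  map_smul' _ _ := rfl
  invFun φ := ⟨fun _ => LinearMap.toContinuousLinearMap φ, differentiable_const _⟩
  left_inv η := by
    refine Subtype.ext (funext fun y => ?_)
    rw [P.oneForm_eq η y]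
    rfl
  right_inv φ := rfl

instance PPAV.finite_oneForms : FiniteDimensional ℂ P.OneForms :=
  Module.Finite.equiv P.oneFormsEquiv.symm

/-- This is biduality for `W`, transported along the identification of one-forms with linear forms.
-/
theorem PPAV.tangentToDual_bijective : Function.Bijective P.tangentToDual := by
  have h : P.tangentToDual =
      ((Module.evalEquiv ℂ W).trans P.oneFormsEquiv.dualMap).toLinearMap := rfl
  rw [h]
  exact LinearEquiv.bijective _

end OneForms

/-! ### Polynomial functions and the symmetric algebra -/

section SymmetricAlgebra

variable {D M E : Type*} [AddCommMonoid D] [Module ℂ D] [AddCommMonoid M] [Module ℂ M]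
  [AddCommGroup E] [Module ℂ E]

/-- The isomorphism of symmetric algebras induced by a linear isomorphism. -/
def symCongr (e : D ≃ₗ[ℂ] M) : SymmetricAlgebra ℂ D ≃ₐ[ℂ] SymmetricAlgebra ℂ M :=
  AlgEquiv.ofAlgHom (SymmetricAlgebra.lift (SymmetricAlgebra.ι ℂ M ∘ₗ e.toLinearMap))
    (SymmetricAlgebra.lift (SymmetricAlgebra.ι ℂ D ∘ₗ e.symm.toLinearMap))
    (SymmetricAlgebra.algHom_ext (LinearMap.ext fun x => by simp))
    (SymmetricAlgebra.algHom_ext (LinearMap.ext fun x => by simp))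

theorem symCongr_ι (e : D ≃ₗ[ℂ] M) (d : D) :
    symCongr e (SymmetricAlgebra.ι ℂ D d) = SymmetricAlgebra.ι ℂ M (e d) :=
  SymmetricAlgebra.lift_ι_apply _ d

/-- All uniqueness statements rest on this: a linear map out of the coinvariants is tested on
products of generators, the empty product included. -/
theorem span_list_prod_eq_top {I : Type*} {t : I → M} (ht : Submodule.span ℂ (Set.range t) = ⊤) :
    Submodule.span ℂ (Set.range fun l : List I =>
      (l.map fun i => SymmetricAlgebra.ι ℂ M (t i)).prod) = ⊤ := by
  set f : I → SymmetricAlgebra ℂ M := fun i => SymmetricAlgebra.ι ℂ M (t i) with hf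
  have hadj : Algebra.adjoin ℂ (Set.range f) = ⊤ := by
    refine eq_top_iff.2 fun s _ => ?_
    induction s using SymmetricAlgebra.induction with
    | algebraMap c => exact Subalgebra.algebraMap_mem _ c
    | mul a b ha hb => exact Subalgebra.mul_mem _ (ha trivial) (hb trivial)
    | add a b ha hb => exact Subalgebra.add_mem _ (ha trivial) (hb trivial)
    | ι x =>
      have hx : x ∈ Submodule.span ℂ (Set.range t) := ht ▸ Submodule.mem_top
      have h := Submodule.mem_map_of_mem (f := SymmetricAlgebra.ι ℂ M) hx
      rw [Submodule.map_span, ← Set.range_comp] at h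
      exact Algebra.span_le_adjoin ℂ _ h
  have h := Algebra.adjoin_eq_span ℂ (Set.range f)
  rw [hadj, Algebra.top_toSubmodule] at h
  rw [eq_top_iff, h]
  refine Submodule.span_mono fun s hs => ?_
  obtain ⟨l, hl, rfl⟩ := Submonoid.exists_list_of_mem_closure hs
  have : l ∈ Set.range (List.map f) := by
    rw [Set.range_list_map]
    exact hl
  obtain ⟨m, rfl⟩ := this
  exact ⟨m, rfl⟩

/-- The homomorphism to functions on `E` induced by a linear map to the dual of `E`. -/
def symToFun (θ : D →ₗ[ℂ] Module.Dual ℂ E) : SymmetricAlgebra ℂ D →ₐ[ℂ] (E → ℂ) :=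
  SymmetricAlgebra.lift
    { toFun := fun d => ⇑(θ d)
      map_add' := fun d d' => by rw [map_add]; rfl
      map_smul' := fun c d => by rw [map_smul]; rfl }

theorem symToFun_ι (θ : D →ₗ[ℂ] Module.Dual ℂ E) (d : D) :
    symToFun θ (SymmetricAlgebra.ι ℂ D d) = ⇑(θ d) := SymmetricAlgebra.lift_ι_apply _ d

theorem range_symToFun (θ : D ≃ₗ[ℂ] Module.Dual ℂ E) :
    (symToFun θ.toLinearMap).range = Fun E := by
  refine le_antisymm ?_ (Algebra.adjoin_le ?_)
  · rintro _ ⟨s, rfl⟩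
    change symToFun θ.toLinearMap s ∈ Fun E
    induction s using SymmetricAlgebra.induction with
    | algebraMap c => rw [AlgHom.commutes]; exact Subalgebra.algebraMap_mem _ c
    | mul a b ha hb => rw [map_mul]; exact Subalgebra.mul_mem _ ha hb
    | add a b ha hb => rw [map_add]; exact Subalgebra.add_mem _ ha hb
    | ι d => rw [symToFun_ι]; exact Algebra.subset_adjoin ⟨θ d, rfl⟩
  · rintro _ ⟨ψ, rfl⟩
    refine ⟨SymmetricAlgebra.ι ℂ D (θ.symm ψ), ?_⟩
    change symToFun θ.toLinearMap _ = _
    rw [symToFun_ι, LinearEquiv.coe_coe, LinearEquiv.apply_symm_apply]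

/-- In coordinates `symToFun` is evaluation of polynomials, and a polynomial over the infinite field
`ℂ` that vanishes at every point is zero. -/
theorem symToFun_injective [FiniteDimensional ℂ E] (θ : D ≃ₗ[ℂ] Module.Dual ℂ E) :
    Function.Injective (symToFun θ.toLinearMap) := by
  classical
  let b := Module.finBasis ℂ E
  let bD := b.dualBasis.map θ.symm
  have key (e : E) : (Pi.evalAlgHom ℂ (fun _ : E => ℂ) e).comp (symToFun θ.toLinearMap) =
      (MvPolynomial.aeval (b.equivFun e)).comp
        (SymmetricAlgebra.equivMvPolynomial bD : _ →ₐ[ℂ] _) := by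
    refine SymmetricAlgebra.algHom_ext (bD.ext fun i => ?_)
    change symToFun θ.toLinearMap (SymmetricAlgebra.ι ℂ D (bD i)) e =
      MvPolynomial.aeval (b.equivFun e)
        (SymmetricAlgebra.equivMvPolynomial bD (SymmetricAlgebra.ι ℂ D (bD i)))
    rw [symToFun_ι, SymmetricAlgebra.equivMvPolynomial_ι_apply, MvPolynomial.aeval_X]
    simp [bD]
  intro s s' h
  refine (SymmetricAlgebra.equivMvPolynomial bD).injective (MvPolynomial.funext fun y => ?_)
  have h1 := AlgHom.congr_fun (key (b.equivFun.symm y)) s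
  have h2 := AlgHom.congr_fun (key (b.equivFun.symm y)) s'
  have h3 : Pi.evalAlgHom ℂ (fun _ : E => ℂ) (b.equivFun.symm y) (symToFun θ.toLinearMap s) =
      Pi.evalAlgHom ℂ (fun _ : E => ℂ) (b.equivFun.symm y) (symToFun θ.toLinearMap s') := by rw [h]
  rw [AlgHom.comp_apply, AlgHom.comp_apply, LinearEquiv.apply_symm_apply] at h1 h2
  exact h1.symm.trans (h3.trans h2)

/-- The ring of polynomial functions on a finite-dimensional space is the symmetric algebra of its
dual. -/
def symFunEquiv [FiniteDimensional ℂ E] (θ : D ≃ₗ[ℂ] Module.Dual ℂ E) :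
    SymmetricAlgebra ℂ D ≃ₐ[ℂ] Fun E :=
  (AlgEquiv.ofInjective _ (symToFun_injective θ)).trans
    (Subalgebra.equivOfEq _ _ (range_symToFun θ))

theorem symFunEquiv_list_prod [FiniteDimensional ℂ E] (θ : D ≃ₗ[ℂ] Module.Dual ℂ E)
    {I : Type*} (l : List I) (d : I → D) (e : E) :
    (symFunEquiv θ (l.map fun i => SymmetricAlgebra.ι ℂ D (d i)).prod).1 e =
      (l.map fun i => θ (d i) e).prod := by
  change symToFun θ.toLinearMap _ e = _
  rw [map_list_prod, List.map_map]
  induction l with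
  | nil => rfl
  | cons i l ih =>
    rw [List.map_cons, List.map_cons, List.prod_cons, List.prod_cons, Pi.mul_apply, ih,
      Function.comp_apply, symToFun_ι]
    rfl

end SymmetricAlgebra

/-! ### Nondegeneracy of the form on the Cartan algebra -/

section Cartan

variable {Γ : Type*} [AddCommGroup Γ] [Module.Free ℤ Γ] [Module.Finite ℤ Γ] (q : EvenLattice Γ)

/-- Definiteness makes the integral Gram determinant nonzero, and it stays nonzero in `ℂ`. -/
theorem cartanForm_nondegenerate : (cartanForm q).Nondegenerate := by
  classical
  let b := Module.Free.chooseBasis ℤ Γ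
  have hq : q.q.Nondegenerate := by
    refine ⟨fun x hx => ?_, fun x hx => ?_⟩ <;>
    · by_contra h
      exact (q.positive x h).ne' (hx x)
  rw [LinearMap.BilinForm.nondegenerate_iff_det_ne_zero b] at hq
  rw [LinearMap.BilinForm.nondegenerate_iff_det_ne_zero (Algebra.TensorProduct.basis ℂ b)]
  have : LinearMap.BilinForm.toMatrix (Algebra.TensorProduct.basis ℂ b) (cartanForm q) =
      (LinearMap.BilinForm.toMatrix b q.q).map fun n => (n : ℂ) := by
    ext i j
    simp [LinearMap.BilinForm.toMatrix_apply, cartanForm, LinearMap.BilinForm.baseChange_tmul]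
  rw [this, ← Int.cast_det]
  exact_mod_cast hq

variable {M : Type*} [AddCommGroup M] [Module ℂ M] [FiniteDimensional ℂ M]

/-- The perfect pairing between `𝔥_Γ ⊗ M^*` and `𝔥_Γ ⊗ M`. -/
def pairingEquiv : Cartan Γ ⊗[ℂ] Module.Dual ℂ M ≃ₗ[ℂ] Module.Dual ℂ (Cartan Γ ⊗[ℂ] M) :=
  (TensorProduct.congr ((cartanForm q).toDual (cartanForm_nondegenerate q))
    (LinearEquiv.refl ℂ (Module.Dual ℂ M))).trans (TensorProduct.dualDistribEquiv ℂ (Cartan Γ) M)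

theorem pairingEquiv_tmul (A : Cartan Γ) (u : Module.Dual ℂ M) :
    pairingEquiv q (A ⊗ₜ u) = pairing q A u := by
  refine TensorProduct.ext' fun B m => ?_
  change TensorProduct.dualDistrib ℂ (Cartan Γ) M
    ((cartanForm q).toDual (cartanForm_nondegenerate q) A ⊗ₜ u) (B ⊗ₜ m) = _
  rw [TensorProduct.dualDistrib_apply, LinearMap.BilinForm.toDual_def]
  rfl

end Cartan

/-! ### Coinvariants of a PPAV -/

section Coinvariants

variable {Γ : Type*} [AddCommGroup Γ] (q : EvenLattice Γ)
  {W : Type*} [NormedAddCommGroup W] [NormedSpace ℂ W] {P : PPAV W}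

namespace Sp

/-- The extension by `0` on `H'₊` of the map `Z → H⁰(X, Ω¹)^*`. -/
def extDual (x : Sp P) : H' →ₗ[ℂ] Module.Dual ℂ P.OneForms :=
  x.toDual ∘ₗ x.a.Z.projectionOnto Hplus x.isCompl

theorem extDual_coe (x : Sp P) (z : x.a.Z) : x.extDual z.1 = x.toDual z := by
  rw [extDual, LinearMap.comp_apply, Submodule.projectionOnto_apply_left]

theorem extDual_Hplus (x : Sp P) {k : H'} (hk : k ∈ Hplus) : x.extDual k = 0 := by
  rw [extDual, LinearMap.comp_apply, Submodule.projectionOnto_apply_of_mem_right _ hk, map_zero]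

theorem extDual_moves {x x' : Sp P} {ρ : SpFull} (h : Moves ρ x x') (f : H') :
    x'.extDual (ρ.1 f) = x.extDual f := by
  obtain ⟨z, k, hk, rfl⟩ := x.exists_add f
  rw [map_add, map_add, map_add, x.extDual_Hplus hk, x'.extDual_Hplus ((ρ.2.2.2.2 k).2 hk),
    add_zero, add_zero, extDual_coe, x'.extDual_coe ⟨_, (h.map_Z z.1).2 z.2⟩]
  exact congrArg P.tangentToDual (h.map_iso z ⟨_, (h.map_Z z.1).2 z.2⟩ rfl)

variable [FiniteDimensional ℂ W]

theorem toDual_surjective (x : Sp P) : Function.Surjective x.toDual :=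
  P.tangentToDual_bijective.surjective.comp x.proj_surjective

theorem toDual_eq_zero (x : Sp P) (z : x.a.Z) : x.toDual z = 0 ↔ z.1 ∈ x.a.F := by
  rw [← x.proj_eq_zero]
  exact map_eq_zero_iff P.tangentToDual P.tangentToDual_bijective.injective

theorem extDual_surjective (x : Sp P) : Function.Surjective x.extDual :=
  x.toDual_surjective.comp (Submodule.projectionOnto_surjective _)

theorem ker_extDual (x : Sp P) : LinearMap.ker x.extDual = x.a.F ⊔ Hplus := by
  refine le_antisymm (fun f hf => ?_) (sup_le (fun f hf => ?_) fun f hf => x.extDual_Hplus hf)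
  · obtain ⟨z, k, hk, rfl⟩ := x.exists_add f
    rw [LinearMap.mem_ker, map_add, x.extDual_Hplus hk, add_zero, extDual_coe,
      toDual_eq_zero] at hf
    exact Submodule.add_mem_sup hf hk
  · rw [LinearMap.mem_ker, x.extDual_coe ⟨f, x.a.F_le hf⟩]
    exact (x.toDual_eq_zero _).2 hf

/-- The coinvariants at a point of `Sp(X, Θ)`. -/
def fiberEquiv (x : Sp P) :
    ExtCoinv q 0 x.a.F ≃ₗ[ℂ] SymmetricAlgebra ℂ (Cartan Γ ⊗[ℂ] Module.Dual ℂ P.OneForms) :=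
  coinvEquiv q x.extDual x.extDual_surjective x.ker_extDual

theorem fiberEquiv_monomial (x : Sp P) (l : List (Cartan Γ × x.a.Z)) :
    x.fiberEquiv q ((outSub q 0 x.a.F).mkQ (monomial q 0 (l.map fun p => (p.1, p.2.1)))) =
      (l.map fun p => SymmetricAlgebra.ι ℂ _ (p.1 ⊗ₜ[ℂ] x.toDual p.2)).prod := by
  rw [fiberEquiv, coinvEquiv_monomial, List.map_map]
  congr 2
  funext p
  rw [Function.comp_apply, extDual_coe]

theorem fiberEquiv_moves {x x' : Sp P} {ρ : SpFull} (h : Moves ρ x x') (c : ExtCoinv q 0 x.a.F) :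
    x'.fiberEquiv q (coinvMap q ρ 0 h.map_F c) = x.fiberEquiv q c :=
  coinvEquiv_coinvMap q _ _ _ _ (extDual_moves h) _ c

end Sp

variable [FiniteDimensional ℂ W]

theorem fiberEquiv_eq (v : Coinv q 0 P) (x x' : Sp P) :
    x'.fiberEquiv q (v.1 x') = x.fiberEquiv q (v.1 x) := by
  obtain ⟨ρ, hρ, h⟩ := Sp.exists_moves x x'
  rw [← v.2 ρ hρ x x' h, Sp.fiberEquiv_moves q h]

/-- Seen in the fixed symmetric algebra, an invariant family is constant by transitivity, which
gives injectivity. Conversely any constant gives an invariant family, because moves act there as the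
identity. -/
theorem eval_bijective (x : Sp P) : Function.Bijective fun v : Coinv q 0 P => v.1 x := by
  constructor
  · intro v w hvw
    refine Subtype.ext (funext fun x' => (x'.fiberEquiv q).injective ?_)
    rw [fiberEquiv_eq q v x, fiberEquiv_eq q w x]
    exact congrArg _ hvw
  · intro c
    refine ⟨⟨fun x' => (x'.fiberEquiv q).symm (x.fiberEquiv q c), fun ρ _ y y' h => ?_⟩, ?_⟩
    · refine (y'.fiberEquiv q).injective ?_
      rw [Sp.fiberEquiv_moves q h, LinearEquiv.apply_symm_apply, LinearEquiv.apply_symm_apply]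
    · exact LinearEquiv.symm_apply_apply _ c

variable (P) in
/-- The canonical isomorphism of the coinvariants with `Sym(𝔥_Γ ⊗ H⁰(X, Ω¹)^*)`. -/
def canonicalEquiv :
    Coinv q 0 P ≃ₗ[ℂ] SymmetricAlgebra ℂ (Cartan Γ ⊗[ℂ] Module.Dual ℂ P.OneForms) :=
  (LinearEquiv.ofBijective
    (LinearMap.proj (φ := fun x : Sp P => ExtCoinv q 0 x.a.F) (nonempty_Sp P).some ∘ₗ
      (Coinv q 0 P).subtype)
    (eval_bijective q (nonempty_Sp P).some)).trans ((nonempty_Sp P).some.fiberEquiv q)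

/-- Independence of the base point chosen in the definition, which is what makes the isomorphism
canonical. -/
theorem canonicalEquiv_apply (v : Coinv q 0 P) (x : Sp P) :
    canonicalEquiv q P v = x.fiberEquiv q (v.1 x) := fiberEquiv_eq q v x _

theorem canonicalEquiv_of_monomial {v : Coinv q 0 P} {x : Sp P} {l : List (Cartan Γ × x.a.Z)}
    (h : v.1 x = (outSub q 0 x.a.F).mkQ (monomial q 0 (l.map fun p => (p.1, p.2.1)))) :
    canonicalEquiv q P v =
      (l.map fun p => SymmetricAlgebra.ι ℂ _ (p.1 ⊗ₜ[ℂ] x.toDual p.2)).prod := by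
  rw [canonicalEquiv_apply q v x, h, Sp.fiberEquiv_monomial]

/-- Linear maps on the coinvariants are determined by their values on monomials. -/
theorem linearMap_ext_of_monomial {V : Type*} [AddCommGroup V] [Module ℂ V] (x : Sp P)
    {I : Type*} {a : I → Cartan Γ × x.a.Z}
    (ha : Submodule.span ℂ (Set.range fun i => (a i).1 ⊗ₜ[ℂ] x.toDual (a i).2) = ⊤)
    {G G' : Coinv q 0 P →ₗ[ℂ] V}
    (h : ∀ (v : Coinv q 0 P) (l : List I), v.1 x =
      (outSub q 0 x.a.F).mkQ (monomial q 0 (l.map fun i => ((a i).1, (a i).2.1))) → G v = G' v) :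
    G = G' := by
  have hcomp : G ∘ₗ (canonicalEquiv q P).symm.toLinearMap =
      G' ∘ₗ (canonicalEquiv q P).symm.toLinearMap := by
    refine LinearMap.ext_on (span_list_prod_eq_top ha) ?_
    rintro _ ⟨l, rfl⟩
    -- The family that corresponds to a product of generators has the matching monomial as its value
    -- at `x`, since `fiberEquiv` is injective.
    refine h _ l ((x.fiberEquiv q).injective ?_)
    rw [← canonicalEquiv_apply, LinearEquiv.coe_coe, LinearEquiv.apply_symm_apply]
    have := x.fiberEquiv_monomial q (l.map a)
    rw [List.map_map, List.map_map] at this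
    exact this.symm
  refine LinearMap.ext fun v => ?_
  have := LinearMap.congr_fun hcomp (canonicalEquiv q P v)
  simpa using this

theorem span_tmul_toDual (x : Sp P) : Submodule.span ℂ (Set.range fun p : Cartan Γ × x.a.Z =>
    p.1 ⊗ₜ[ℂ] x.toDual p.2) = ⊤ := by
  rw [← TensorProduct.span_tmul_eq_top ℂ (Cartan Γ) (Module.Dual ℂ P.OneForms)]
  congr 1
  ext t
  constructor
  · rintro ⟨p, rfl⟩
    exact ⟨p.1, _, rfl⟩
  · rintro ⟨A, d, rfl⟩
    obtain ⟨z, rfl⟩ := x.toDual_surjective d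
    exact ⟨(A, z), rfl⟩

theorem span_tmul_toDual_of_span {h : Cartan Γ} (hh : Submodule.span ℂ {h} = ⊤) (x : Sp P) :
    Submodule.span ℂ (Set.range fun z : x.a.Z => h ⊗ₜ[ℂ] x.toDual z) = ⊤ := by
  rw [eq_top_iff, ← span_tmul_toDual x, Submodule.span_le]
  rintro _ ⟨⟨A, z⟩, rfl⟩
  obtain ⟨c, rfl⟩ := Submodule.mem_span_singleton.1
    (hh ▸ Submodule.mem_top : A ∈ Submodule.span ℂ {h})
  refine Submodule.subset_span ⟨c • z, ?_⟩
  simp only [map_smul, TensorProduct.tmul_smul, TensorProduct.smul_tmul']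

/-- The isomorphism `M ≅ 𝔥_Γ ⊗ M` given by a vector that spans `𝔥_Γ`. -/
def tmulEquiv {h : Cartan Γ} (h0 : h ≠ 0) (hh : Submodule.span ℂ {h} = ⊤) (M : Type*)
    [AddCommGroup M] [Module ℂ M] : M ≃ₗ[ℂ] Cartan Γ ⊗[ℂ] M :=
  (TensorProduct.lid ℂ M).symm.trans (TensorProduct.congr
    (LinearEquiv.ofBijective (LinearMap.toSpanSingleton ℂ (Cartan Γ) h)
      ⟨smul_left_injective ℂ h0, fun A => Submodule.mem_span_singleton.1
        (hh ▸ Submodule.mem_top : A ∈ Submodule.span ℂ {h})⟩)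
    (LinearEquiv.refl ℂ M))

theorem tmulEquiv_apply {h : Cartan Γ} (h0 : h ≠ 0) (hh : Submodule.span ℂ {h} = ⊤) {M : Type*}
    [AddCommGroup M] [Module ℂ M] (m : M) : tmulEquiv h0 hh M m = h ⊗ₜ m := by
  change ((1 : ℂ) • h) ⊗ₜ[ℂ] m = _
  rw [one_smul]

end Coinvariants

/-! ### Polynomial functions and rank one -/

section Functions

variable {Γ : Type*} [AddCommGroup Γ] (q : EvenLattice Γ)
  {W : Type*} [NormedAddCommGroup W] [NormedSpace ℂ W] [FiniteDimensional ℂ W] {P : PPAV W}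

variable (P) in
/-- The canonical isomorphism of the coinvariants with the polynomial functions on
`𝔥_Γ ⊗ H⁰(X, Ω¹)`. -/
def canonicalFunEquiv [Module.Free ℤ Γ] [Module.Finite ℤ Γ] :
    Coinv q 0 P ≃ₗ[ℂ] Fun (Cartan Γ ⊗[ℂ] P.OneForms) :=
  (canonicalEquiv q P).trans
    (symFunEquiv (E := Cartan Γ ⊗[ℂ] P.OneForms) (pairingEquiv q (M := P.OneForms))).toLinearEquiv

theorem canonicalFunEquiv_of_monomial [Module.Free ℤ Γ] [Module.Finite ℤ Γ] {v : Coinv q 0 P}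
    {x : Sp P} {l : List (Cartan Γ × x.a.Z)}
    (h : v.1 x = (outSub q 0 x.a.F).mkQ (monomial q 0 (l.map fun p => (p.1, p.2.1))))
    (y : Cartan Γ ⊗[ℂ] P.OneForms) :
    (canonicalFunEquiv q P v).1 y = (l.map fun p => pairing q p.1 (x.toDual p.2) y).prod := by
  change (symFunEquiv (E := Cartan Γ ⊗[ℂ] P.OneForms) (pairingEquiv q (M := P.OneForms))
    (canonicalEquiv q P v)).1 y = _
  rw [canonicalEquiv_of_monomial q h, symFunEquiv_list_prod]
  simp only [pairingEquiv_tmul]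

variable {h : Cartan Γ} (h0 : h ≠ 0) (hh : Submodule.span ℂ {h} = ⊤)

variable (P) in
/-- The isomorphism of the coinvariants with `Sym(H⁰(X, Ω¹)^*)` given by a vector that spans
`𝔥_Γ`. -/
def rankOneEquiv : Coinv q 0 P ≃ₗ[ℂ] SymmetricAlgebra ℂ (Module.Dual ℂ P.OneForms) :=
  (canonicalEquiv q P).trans
    (symCongr (tmulEquiv h0 hh (Module.Dual ℂ P.OneForms)).symm).toLinearEquiv

theorem rankOneEquiv_of_monomial {v : Coinv q 0 P} {x : Sp P} {l : List x.a.Z}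
    (hv : v.1 x = (outSub q 0 x.a.F).mkQ (monomial q 0 (l.map fun f => (h, f.1)))) :
    rankOneEquiv q P h0 hh v = (l.map fun f => SymmetricAlgebra.ι ℂ _ (x.toDual f)).prod := by
  have hv' : v.1 x = (outSub q 0 x.a.F).mkQ
      (monomial q 0 ((l.map fun f => (h, f)).map fun p => (p.1, p.2.1))) := by
    rw [hv, List.map_map]
    rfl
  change symCongr (tmulEquiv h0 hh (Module.Dual ℂ P.OneForms)).symm (canonicalEquiv q P v) = _
  rw [canonicalEquiv_of_monomial q hv', map_list_prod, List.map_map, List.map_map]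
  congr 2
  funext f
  simp only [Function.comp_apply]
  rw [symCongr_ι, ← tmulEquiv_apply h0 hh, LinearEquiv.symm_apply_apply]

variable (P) in
/-- The isomorphism of the coinvariants with the polynomial functions on `H⁰(X, Ω¹)` given by a
vector that spans `𝔥_Γ`. -/
def rankOneFunEquiv : Coinv q 0 P ≃ₗ[ℂ] Fun P.OneForms :=
  (rankOneEquiv q P h0 hh).trans
    (symFunEquiv (E := P.OneForms) (LinearEquiv.refl ℂ (Module.Dual ℂ P.OneForms))).toLinearEquiv

theorem rankOneFunEquiv_of_monomial {v : Coinv q 0 P} {x : Sp P} {l : List x.a.Z}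
    (hv : v.1 x = (outSub q 0 x.a.F).mkQ (monomial q 0 (l.map fun f => (h, f.1))))
    (η : P.OneForms) :
    (rankOneFunEquiv q P h0 hh v).1 η = (l.map fun f => x.toDual f η).prod := by
  change (symFunEquiv (LinearEquiv.refl ℂ (Module.Dual ℂ P.OneForms))
    (rankOneEquiv q P h0 hh v)).1 η = _
  rw [rankOneEquiv_of_monomial q h0 hh hv, symFunEquiv_list_prod]
  rfl

end Functions

end AbelianCoinvariants

end

/-! ### The main theorem -/

theorem theorem5p4 {Γ : Type*} [AddCommGroup Γ] [Module.Free ℤ Γ] [Module.Finite ℤ Γ]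
    (q : EvenLattice Γ)
    {W : Type*} [NormedAddCommGroup W] [NormedSpace ℂ W] [FiniteDimensional ℂ W]
    (P : PPAV W) :
    -- the descended space has the coinvariants at each point of `Sp(X, Θ)` as its fiber
    (∀ x : Sp P, Function.Bijective fun v : Coinv q 0 P => v.1 x) ∧
    -- the canonical isomorphism with `Sym(𝔥_Γ ⊗ H⁰(X, Ω¹)^*)`
    (∃! Φ : Coinv q 0 P ≃ₗ[ℂ]
          SymmetricAlgebra ℂ (Cartan Γ ⊗[ℂ] Module.Dual ℂ P.OneForms),
        ∀ (v : Coinv q 0 P) (x : Sp P) (l : List (Cartan Γ × x.a.Z)),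
          v.1 x = (outSub q 0 x.a.F).mkQ (monomial q 0 (l.map fun p => (p.1, p.2.1))) →
          Φ v = (l.map fun p => SymmetricAlgebra.ι ℂ _ (p.1 ⊗ₜ[ℂ] x.toDual p.2)).prod) ∧
    -- the canonical isomorphism with `Fun(𝔥_Γ ⊗ H⁰(X, Ω¹))`
    (∃! Ψ : Coinv q 0 P ≃ₗ[ℂ] Fun (Cartan Γ ⊗[ℂ] P.OneForms),
        ∀ (v : Coinv q 0 P) (x : Sp P) (l : List (Cartan Γ × x.a.Z)),
          v.1 x = (outSub q 0 x.a.F).mkQ (monomial q 0 (l.map fun p => (p.1, p.2.1))) →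
          ∀ y : Cartan Γ ⊗[ℂ] P.OneForms,
            (Ψ v).1 y = (l.map fun p => pairing q p.1 (x.toDual p.2) y).prod) ∧
    -- the case of rank one, where `𝔥_Γ` is spanned by a vector `h` with `(h, h) = 1`
    (Module.finrank ℤ Γ = 1 → ∀ h : Cartan Γ, cartanForm q h h = 1 →
      (∃! Φ : Coinv q 0 P ≃ₗ[ℂ] SymmetricAlgebra ℂ (Module.Dual ℂ P.OneForms),
        ∀ (v : Coinv q 0 P) (x : Sp P) (l : List x.a.Z),
          v.1 x = (outSub q 0 x.a.F).mkQ (monomial q 0 (l.map fun f => (h, f.1))) →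
          Φ v = (l.map fun f => SymmetricAlgebra.ι ℂ _ (x.toDual f)).prod) ∧
      (∃! Ψ : Coinv q 0 P ≃ₗ[ℂ] Fun P.OneForms,
        ∀ (v : Coinv q 0 P) (x : Sp P) (l : List x.a.Z),
          v.1 x = (outSub q 0 x.a.F).mkQ (monomial q 0 (l.map fun f => (h, f.1))) →
          ∀ η : P.OneForms, (Ψ v).1 η = (l.map fun f => x.toDual f η).prod)) := by
  obtain ⟨x₀⟩ := nonempty_Sp P
  refine ⟨eval_bijective q, ⟨canonicalEquiv q P, fun v x l hv => canonicalEquiv_of_monomial q hv,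
    fun Φ hΦ => ?_⟩, ⟨canonicalFunEquiv q P,
    fun v x l hv => canonicalFunEquiv_of_monomial q hv, fun Ψ hΨ => ?_⟩, fun hrank h hh => ?_⟩
  -- Uniqueness needs the defining property only at the single point `x₀`, where monomials already
  -- span the fiber.
  · refine LinearEquiv.toLinearMap_injective (linearMap_ext_of_monomial q x₀
      (span_tmul_toDual x₀) fun v l hv => ?_)
    exact (hΦ v x₀ l hv).trans (canonicalEquiv_of_monomial q hv).symm
  · refine LinearEquiv.toLinearMap_injective (linearMap_ext_of_monomial q x₀
      (span_tmul_toDual x₀) fun v l hv => Subtype.ext (funext fun y => ?_))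
    exact (hΨ v x₀ l hv y).trans (canonicalFunEquiv_of_monomial q hv y).symm
  · have h0 : h ≠ 0 := by
      rintro rfl
      simp at hh
    have hspan : Submodule.span ℂ {h} = ⊤ :=
      (finrank_eq_one_iff_of_nonzero h h0).1 (Module.finrank_baseChange.trans hrank)
    refine ⟨⟨rankOneEquiv q P h0 hspan, fun v x l hv => rankOneEquiv_of_monomial q h0 hspan hv,
      fun Φ hΦ => ?_⟩, ⟨rankOneFunEquiv q P h0 hspan,
      fun v x l hv => rankOneFunEquiv_of_monomial q h0 hspan hv, fun Ψ hΨ => ?_⟩⟩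
    · refine LinearEquiv.toLinearMap_injective (linearMap_ext_of_monomial q x₀
        (a := fun z => (h, z)) (span_tmul_toDual_of_span hspan x₀) fun v l hv => ?_)
      exact (hΦ v x₀ l hv).trans (rankOneEquiv_of_monomial q h0 hspan hv).symm
    · refine LinearEquiv.toLinearMap_injective (linearMap_ext_of_monomial q x₀
        (a := fun z => (h, z)) (span_tmul_toDual_of_span hspan x₀)
        fun v l hv => Subtype.ext (funext fun y => ?_))
      exact (hΨ v x₀ l hv y).trans (rankOneFunEquiv_of_monomial q h0 hspan hv y).symm
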